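/- Let $\mathbb D$ be the open unit disc and $\mathbb T$ the unit circle. Let $\widehat\Theta$ be the set of Borel probability measures $\vartheta$ on $\mathbb T$ with $\int_{\mathbb T} w\,d\vartheta(w)=0$ whose support consists of exactly two or exactly three points, and for $\vartheta\in\widehat\Theta$ put $$h_\vartheta(z)=\int_{\mathbb T}\frac{w+z}{w-z}\,d\vartheta(w),\qquad \psi_\vartheta(z)=\frac{h_\vartheta(z)-1}{h_\vartheta(z)+1}\qquad(z\in\mathbb D).$$ Let $\Theta\subset\widehat\Theta$ be the set of those $\vartheta$ whose support contains $-1$ (these represent the classes of $\widehat\Theta$ under the relation that identifies two measures when their functions $\psi$ differ by a unimodular constant), and let $\Psi=\{\psi_\vartheta:\vartheta\in\Theta\}$. Let $\mathcal K_\Psi$ be the set of positive (semidefinite) kernels $k:\mathbb D\times\mathbb D\to\mathbb C$ for which the kernel $(1-\psi(x)\overline{\psi(y)})k(x,y)$ is positive for every $\psi\in\Psi$. Let $H^\infty(\mathcal K_\Psi)$ be the space of functions on $\mathbb D$ whose closed unit ball $B$ consists of all $f:\mathbb D\to\mathbb C$ such that $(1-f(x)\overline{f(y)})k(x,y)$ is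 a positive kernel for every $k\in\mathcal K_\Psi$; that is, $H^\infty(\mathcal K_\Psi)=\bigcup_{r>0}rB$ and $\|f\|_{\mathcal K_\Psi}=\inf\{r>0: r^{-1}f\in B\}$. Let $H^\infty_1(\mathbb D)$ be the space of bounded holomorphic functions $g$ on $\mathbb D$ with $g'(0)=0$, normed by $\|g\|_\infty=\sup_{z\in\mathbb D}|g(z)|$. Then: 1. $\Psi$ is a set of test functions on $\mathbb D$: $\sup_{\psi\in\Psi}|\psi(z)|<1$ for each $z\in\mathbb D$, and for each finite set $F\subset\mathbb D$ with $n$ elements the unital algebra of functions on $F$ generated by the restrictions $\psi|_F$, $\psi\in\Psi$, is $n$-dimensional. 2. $H^\infty(\mathcal K_\Psi)=H^\infty_1(\mathbb D)$ as sets of functions on $\mathbb D$, and $\|f\|_{\mathcal K_\Psi}=\|f\|_\infty$ for every $f$ in this space. -/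

import Mathlib

open MeasureTheory
open scoped ComplexConjugate ComplexOrder

noncomputable section

namespace ConstrainedInterpolation

/-! ### Test functions and the space attached to them -/

/-- `k` is a positive kernel on `X`: it is Hermitian, and every finite sum
`∑ i, ∑ j, conj (c i) * k (x i) (x j) * c j` is nonnegative. -/
def IsPositiveKernel {X : Type*} (k : X → X → ℂ) : Prop :=
  (Matrix.of k).PosSemidef

/-- The kernel `(1 - f(x) conj(f(y))) k(x, y)`. -/
def pickKernel {X : Type*} (f : X → ℂ) (k : X → X → ℂ) : X → X → ℂ :=
  fun x y => (1 - f x * conj (f y)) * k x y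

/-- A set of test functions on `X`: the values at each point are bounded by a constant less than
one (the supremum is less than one), and over each finite set `F` of `n` points the restrictions
generate a unital algebra of dimension `n`. -/
structure IsTestFunctionSet {X : Type*} (Ψ : Set (X → ℂ)) : Prop where
  sup_lt_one : ∀ x : X, ∃ c : ℝ, c < 1 ∧ ∀ ψ ∈ Ψ, ‖ψ x‖ ≤ c
  finrank_adjoin : ∀ F : Finset X,
    Module.finrank ℂ (Algebra.adjoin ℂ ((fun (ψ : X → ℂ) (x : F) => ψ x) '' Ψ)) = F.card

/-- The positive kernels `k` with `(1 - ψ(x) conj(ψ(y))) k(x, y) ≥ 0` for all `ψ ∈ Ψ`. -/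
def kernels {X : Type*} (Ψ : Set (X → ℂ)) : Set (X → X → ℂ) :=
  {k | IsPositiveKernel k ∧ ∀ ψ ∈ Ψ, IsPositiveKernel (pickKernel ψ k)}

/-- The closed unit ball of `H^∞(K)`. -/
def kernelUnitBall {X : Type*} (K : Set (X → X → ℂ)) : Set (X → ℂ) :=
  {f | ∀ k ∈ K, IsPositiveKernel (pickKernel f k)}

/-- The space `H^∞(K)`, spanned by its unit ball. -/
def kernelSpace {X : Type*} (K : Set (X → X → ℂ)) : Set (X → ℂ) :=
  {f | ∃ r : ℝ, 0 < r ∧ r⁻¹ • f ∈ kernelUnitBall K}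

/-- The norm of `H^∞(K)`: the gauge of its unit ball. -/
def kernelNorm {X : Type*} (K : Set (X → X → ℂ)) (f : X → ℂ) : ℝ :=
  sInf {r : ℝ | 0 < r ∧ r⁻¹ • f ∈ kernelUnitBall K}

/-! ### The space of bounded holomorphic functions with vanishing derivative at the origin -/

/-- `H₁^∞(𝔻)`: the bounded holomorphic functions `f` on the open unit disc with `f'(0) = 0`.
(`F` is an arbitrary extension of `f` to the plane; only its values on the disc matter.) -/
def hInftyOne : Set (Complex.UnitDisc → ℂ) :=
  {f | (∃ F : ℂ → ℂ, (∀ z : Complex.UnitDisc, F z = f z) ∧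
          DifferentiableOn ℂ F (Metric.ball 0 1) ∧ deriv F 0 = 0) ∧
        ∃ M : ℝ, ∀ z : Complex.UnitDisc, ‖f z‖ ≤ M}

/-- The supremum norm on the disc (used for bounded functions only). -/
def supNorm (f : Complex.UnitDisc → ℂ) : ℝ :=
  ⨆ z : Complex.UnitDisc, ‖f z‖

/-! ### The family of test functions -/

/-- The Borel σ-algebra on the unit circle. -/
instance circleMeasurableSpace : MeasurableSpace Circle := borel Circle

instance circleBorelSpace : BorelSpace Circle := ⟨rfl⟩

/-- The zero-mean Borel probability measures on the unit circle that are carried by exactly two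
or exactly three points, each having positive mass. -/
def thetaHat : Set (Measure Circle) :=
  {μ | IsProbabilityMeasure μ ∧ ∫ w : Circle, (w : ℂ) ∂μ = 0 ∧
        ∃ S : Finset Circle, (S.card = 2 ∨ S.card = 3) ∧
          μ (S : Set Circle)ᶜ = 0 ∧ ∀ w ∈ S, 0 < μ {w}}

/-- The measures in `thetaHat` that have the point `-1` in their support. They represent the
classes of measures in `thetaHat` whose test functions agree up to a unimodular constant. -/
def theta : Set (Measure Circle) :=
  {μ | μ ∈ thetaHat ∧ 0 < μ {(-1 : Circle)}}

/-- The Herglotz transform `h_μ(z) = ∫ (w + z) / (w - z) dμ(w)`. -/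
def herglotz (μ : Measure Circle) (z : Complex.UnitDisc) : ℂ :=
  ∫ w : Circle, ((w : ℂ) + z) / ((w : ℂ) - z) ∂μ

/-- The test function `ψ_μ = (h_μ - 1) / (h_μ + 1)`. -/
def testFunction (μ : Measure Circle) (z : Complex.UnitDisc) : ℂ :=
  (herglotz μ z - 1) / (herglotz μ z + 1)

/-- The family `Ψ = {ψ_ϑ : ϑ ∈ Θ}`. -/
def testFamily : Set (Complex.UnitDisc → ℂ) :=
  testFunction '' theta

end ConstrainedInterpolation

end

namespace ConstrainedInterpolation

/-! ### Positive kernels -/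

section PositiveKernel

variable {X : Type*}

/-! The zero-mean condition makes each test function explicit: up to a unimodular constant, which no
Pick kernel sees, two atoms give `z²`, and three atoms with sum `a` give `z² (z - a) / (1 - conj(a)
z)`. Every `a` in the disc occurs with `-1` among the atoms (`exists_three_weights`), so restricting
supports to contain `-1` loses nothing.

A function in the unit ball lies in `hInftyOne` with bound one because a single admissible kernel
already forces it: `gapKernel`, the reproducing kernel of the Hardy space functions with vanishing
derivative at `0`. Positivity on the diagonal bounds `f`. Positivity off the diagonal says that `k_y
↦ conj(f y) k_y` is a contraction, and pairing with `k_0 = 1` exhibits `f` as a power series without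
linear term.

Conversely, let `F` be holomorphic with `|F| ≤ 1` and `F'(0) = 0`, and let `k` be admissible. After
a Cayley transform the claim is that `(h(x) + conj(h(y))) k(x, y)` is positive, where `Re h ≥ 0` and
`h'(0) = 0`. When `h` is holomorphic across the circle, the Herglotz formula writes `h(x) +
conj(h(y))` as the average of `herglotzPairKernel x y` against the density `Re h`, whose first
moment vanishes because `h'(0) = 0`. Admissibility is the required inequality for zero-mean measures
with two or three atoms. A Carathéodory reduction (`sum_mul_nonneg_of_two_or_three_points`) extends
it to finitely many atoms, and a closure argument in moment space
(`circleAverage_mul_nonneg_of_two_or_three_points`) extends it to densities. Scaling and dilation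
limits remove the extra regularity. -/

theorem isPositiveKernel_iff {k : X → X → ℂ} :
    IsPositiveKernel k ↔ (∀ x y, conj (k y x) = k x y) ∧
      ∀ (s : Finset X) (c : X → ℂ), 0 ≤ ∑ x ∈ s, ∑ y ∈ s, conj (c x) * k x y * c y := by
  classical
  refine and_congr ⟨fun h x y => congrFun (congrFun h x) y, fun h => ?_⟩
    ⟨fun h s c => ?_, fun h c => h c.support c⟩
  · ext x y
    exact h x y
  · let d : X →₀ ℂ := Finsupp.onFinset s (fun x => if x ∈ s then c x else 0)
      (fun x hx => by by_contra hxs; simp [hxs] at hx)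
    have hsub : d.support ⊆ s := Finsupp.support_onFinset_subset
    have hz : ∀ x, x ∉ d.support → d x = 0 := fun x hx => by simpa using hx
    have hd : ∀ x ∈ s, d x = c x := fun x hx => by simp [d, hx]
    have h := h d
    change 0 ≤ ∑ x ∈ d.support, ∑ y ∈ d.support, conj (d x) * k x y * d y at h
    rw [Finset.sum_subset hsub fun x _ hx => by simp [hz x hx]] at h
    refine h.trans_eq (Finset.sum_congr rfl fun x hx => ?_)
    rw [Finset.sum_subset hsub fun y _ hy => by simp [hz y hy]]
    exact Finset.sum_congr rfl fun y hy => by rw [hd x hx, hd y hy]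

theorem IsPositiveKernel.congr_conj {k : X → X → ℂ} (hk : IsPositiveKernel k) (g : X → ℂ) :
    IsPositiveKernel (fun x y => g x * k x y * conj (g y)) := by
  rw [isPositiveKernel_iff] at hk ⊢
  refine ⟨fun x y => ?_, fun s c => (hk.2 s fun x => conj (g x) * c x).trans_eq ?_⟩
  · rw [← hk.1 x y]
    simp
    ring
  · refine Finset.sum_congr rfl fun x _ => Finset.sum_congr rfl fun y _ => ?_
    simp
    ring

theorem IsPositiveKernel.add {k l : X → X → ℂ} (hk : IsPositiveKernel k)
    (hl : IsPositiveKernel l) : IsPositiveKernel (fun x y => k x y + l x y) :=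
  Matrix.PosSemidef.add hk hl

theorem isPositiveKernel_inner {H : Type*} [NormedAddCommGroup H] [InnerProductSpace ℂ H]
    (v : X → H) : IsPositiveKernel (fun x y => inner ℂ (v x) (v y)) := by
  rw [isPositiveKernel_iff]
  refine ⟨fun x y => inner_conj_symm _ _, fun s c => ?_⟩
  have : ∑ x ∈ s, ∑ y ∈ s, conj (c x) * inner ℂ (v x) (v y) * c y =
      inner ℂ (∑ x ∈ s, c x • v x) (∑ x ∈ s, c x • v x) := by
    rw [sum_inner]
    refine Finset.sum_congr rfl fun x _ => ?_
    rw [inner_sum]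
    refine Finset.sum_congr rfl fun y _ => ?_
    rw [inner_smul_left, inner_smul_right]
    ring
  rw [this, inner_self_eq_norm_sq_to_K]
  norm_cast
  positivity

theorem isPositiveKernel_mul_conj (g : X → ℂ) :
    IsPositiveKernel (fun x y => g x * conj (g y)) := by
  simpa [mul_comm] using isPositiveKernel_inner (fun x => conj (g x))

theorem isPositiveKernel_of_tendsto {ι : Type*} {u : Filter ι} [u.NeBot] {k : ι → X → X → ℂ}
    {l : X → X → ℂ} (hk : ∀ᶠ i in u, IsPositiveKernel (k i))
    (h : ∀ x y, Filter.Tendsto (fun i => k i x y) u (nhds (l x y))) : IsPositiveKernel l := by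
  rw [isPositiveKernel_iff]
  refine ⟨fun x y => ?_, fun s c => ?_⟩
  · refine tendsto_nhds_unique_of_eventuallyEq
      ((Complex.continuous_conj.tendsto _).comp (h y x)) (h x y) ?_
    filter_upwards [hk] with i hi
    exact (isPositiveKernel_iff.1 hi).1 x y
  · refine ge_of_tendsto (tendsto_finsetSum _ fun x _ => tendsto_finsetSum _ fun y _ =>
      ((h x y).const_mul (conj (c x))).mul_const (c y)) ?_
    filter_upwards [hk] with i hi
    exact (isPositiveKernel_iff.1 hi).2 s c

theorem IsPositiveKernel.diag_nonneg {k : X → X → ℂ} (hk : IsPositiveKernel k) (x : X) :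
    0 ≤ k x x :=
  Matrix.PosSemidef.diag_nonneg (A := Matrix.of k) hk

/-- Multiplying the function by a unimodular constant does not change the Pick kernel. -/
theorem pickKernel_unimodular_mul {u : ℂ} (hu : ‖u‖ = 1) (f : X → ℂ) (k : X → X → ℂ) :
    pickKernel (fun x => u * f x) k = pickKernel f k := by
  have h : u * conj u = 1 := by rw [Complex.mul_conj, Complex.normSq_eq_norm_sq, hu]; simp
  funext x y
  simp only [pickKernel, map_mul]
  linear_combination (-f x * conj (f y) * k x y) * h

/-- Positivity of the Pick kernel of `(h - 1) / (h + 1)` in terms of `h`. -/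
theorem isPositiveKernel_pickKernel_cayley {h : X → ℂ} (hh : ∀ x, h x + 1 ≠ 0) (k : X → X → ℂ) :
    IsPositiveKernel (pickKernel (fun x => (h x - 1) / (h x + 1)) k) ↔
      IsPositiveKernel (fun x y => (h x + conj (h y)) * k x y) := by
  have hh' : ∀ x, conj (h x) + 1 ≠ 0 := fun x e => hh x (by
    have := congrArg conj e
    simpa using this)
  -- The identity behind both directions is `(h + 1)(conj h' + 1) - (h - 1)(conj h' - 1) = 2 (h +
  -- conj h')`; the factor 2 is split evenly between the two variables.
  have s2 : ((Real.sqrt 2 : ℝ) : ℂ) * ((Real.sqrt 2 : ℝ) : ℂ) = 2 := by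
    rw [← Complex.ofReal_mul, Real.mul_self_sqrt (by norm_num)]; simp
  have s0 : ((Real.sqrt 2 : ℝ) : ℂ) ≠ 0 := by simp
  constructor
  · intro H
    convert H.congr_conj (fun x => (h x + 1) / (Real.sqrt 2 : ℝ)) using 3 with x y
    simp only [pickKernel, map_div₀, map_add, map_sub, map_one, Complex.conj_ofReal]
    have := hh x; have := hh' y
    field_simp
    linear_combination k x y * (h x + conj (h y)) * s2
  · intro H
    convert H.congr_conj (fun x => (Real.sqrt 2 : ℝ) / (h x + 1)) using 3 with x y
    simp only [pickKernel, map_div₀, map_add, map_sub, map_one, Complex.conj_ofReal]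
    have := hh x; have := hh' y
    field_simp
    linear_combination -(k x y * (h x + conj (h y))) * s2

end PositiveKernel

/-! ### Herglotz transforms of finitely supported weights -/

/-- The Herglotz transform of the measure with masses `l w` at the points `w ∈ S`. -/
noncomputable def atomicHerglotz (S : Finset Circle) (l : Circle → ℝ) (z : ℂ) : ℂ :=
  ∑ w ∈ S, (l w : ℂ) * (((w : ℂ) + z) / (w - z))

/-- The function `z² (z - a) / (1 - conj(a) z)`. -/
noncomputable def cubicBlaschke (a z : ℂ) : ℂ :=
  z ^ 2 * (z - a) / (1 - conj a * z)

theorem circle_mul_conj (w : Circle) : (w : ℂ) * conj (w : ℂ) = 1 := by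
  rw [Complex.mul_conj, Circle.normSq_coe, Complex.ofReal_one]

theorem circle_sub_ne_zero (w : Circle) {z : ℂ} (hz : ‖z‖ < 1) : (w : ℂ) - z ≠ 0 := by
  intro h
  rw [← sub_eq_zero.1 h, Circle.norm_coe] at hz
  exact lt_irrefl _ hz

theorem one_sub_conj_mul_ne_zero {a z : ℂ} (ha : ‖a‖ ≤ 1) (hz : ‖z‖ < 1) :
    1 - conj a * z ≠ 0 := by
  intro h
  have : ‖conj a * z‖ = 1 := by rw [← sub_eq_zero.1 h, norm_one]
  rw [norm_mul, Complex.norm_conj] at this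
  nlinarith [norm_nonneg z, norm_nonneg a]

theorem re_herglotz_kernel_pos (w : Circle) {z : ℂ} (hz : ‖z‖ < 1) :
    0 < (((w : ℂ) + z) / (w - z)).re := by
  have h := le_re_herglotzRieszKernel (c := 0) (R := 1) (z := w) (w := z)
    (by simp [Circle.norm_coe])
    (by simpa using hz)
  simp only [sub_zero] at h
  exact lt_of_lt_of_le (div_pos (by linarith) (by linarith [norm_nonneg z])) h

theorem re_atomicHerglotz_nonneg {S : Finset Circle} {l : Circle → ℝ} (hl : ∀ w ∈ S, 0 ≤ l w)
    {z : ℂ} (hz : ‖z‖ < 1) : 0 ≤ (atomicHerglotz S l z).re := by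
  rw [atomicHerglotz, Complex.re_sum]
  refine Finset.sum_nonneg fun w hw => ?_
  rw [Complex.re_ofReal_mul]
  exact mul_nonneg (hl w hw) (re_herglotz_kernel_pos w hz).le

theorem atomicHerglotz_add_one_ne_zero {S : Finset Circle} {l : Circle → ℝ}
    (hl : ∀ w ∈ S, 0 ≤ l w) {z : ℂ} (hz : ‖z‖ < 1) : atomicHerglotz S l z + 1 ≠ 0 := by
  intro h
  have h1 := re_atomicHerglotz_nonneg hl hz
  have h2 := congrArg Complex.re h
  simp at h2
  linarith

section Weights

variable {S : Finset Circle} {l : Circle → ℝ}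

theorem atomicHerglotz_add_one (h1 : ∑ w ∈ S, l w = 1) {z : ℂ} (hz : ‖z‖ < 1) :
    atomicHerglotz S l z + 1 = 2 * ∑ w ∈ S, (l w : ℂ) * w / (w - z) := by
  have h1' : ∑ w ∈ S, (l w : ℂ) = 1 := by exact_mod_cast h1
  rw [atomicHerglotz, ← h1', ← Finset.sum_add_distrib, Finset.mul_sum]
  refine Finset.sum_congr rfl fun w _ => ?_
  have := circle_sub_ne_zero w hz
  field_simp
  ring

/-- Total mass one produces one factor `z`; subtracting `2z` times the vanishing conjugate mean
produces the second. This is the source of the `z²` in every test function. -/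
theorem atomicHerglotz_sub_one (h1 : ∑ w ∈ S, l w = 1) (h0 : ∑ w ∈ S, (l w : ℂ) * w = 0)
    {z : ℂ} (hz : ‖z‖ < 1) :
    atomicHerglotz S l z - 1 = 2 * z ^ 2 * ∑ w ∈ S, (l w : ℂ) * conj (w : ℂ) / (w - z) := by
  have h1' : ∑ w ∈ S, (l w : ℂ) = 1 := by exact_mod_cast h1
  have h0' : ∑ w ∈ S, (l w : ℂ) * conj (w : ℂ) = 0 := by
    have := congrArg conj h0
    simpa using this
  have : 2 * z * ∑ w ∈ S, (l w : ℂ) * conj (w : ℂ) = 0 := by rw [h0', mul_zero]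
  rw [← sub_zero (atomicHerglotz S l z - 1), ← this, atomicHerglotz, ← h1',
    ← Finset.sum_sub_distrib, Finset.mul_sum, Finset.mul_sum, ← Finset.sum_sub_distrib]
  refine Finset.sum_congr rfl fun w _ => ?_
  have := circle_sub_ne_zero w hz
  field_simp
  linear_combination (-2 * z * (l w : ℂ)) * circle_mul_conj w

theorem cayley_atomicHerglotz (hl : ∀ w ∈ S, 0 ≤ l w) (h1 : ∑ w ∈ S, l w = 1)
    (h0 : ∑ w ∈ S, (l w : ℂ) * w = 0) {z : ℂ} (hz : ‖z‖ < 1) :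
    (∑ w ∈ S, (l w : ℂ) * w / (w - z)) ≠ 0 ∧
    (atomicHerglotz S l z - 1) / (atomicHerglotz S l z + 1) =
      z ^ 2 * ((∑ w ∈ S, (l w : ℂ) * conj (w : ℂ) / (w - z)) /
        ∑ w ∈ S, (l w : ℂ) * w / (w - z)) := by
  have hne := atomicHerglotz_add_one_ne_zero hl hz
  rw [atomicHerglotz_add_one h1 hz] at hne
  have hne' := right_ne_zero_of_mul hne
  refine ⟨hne', ?_⟩
  rw [atomicHerglotz_add_one h1 hz, atomicHerglotz_sub_one h1 h0 hz]
  field_simp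

/-- Zero mean forces equal masses at antipodal points. -/
theorem exists_cayley_atomicHerglotz_of_card_eq_two (hS : S.card = 2) (hl : ∀ w ∈ S, 0 < l w)
    (h1 : ∑ w ∈ S, l w = 1) (h0 : ∑ w ∈ S, (l w : ℂ) * w = 0) :
    ∃ u : ℂ, ‖u‖ = 1 ∧ ∀ z : ℂ, ‖z‖ < 1 →
      (atomicHerglotz S l z - 1) / (atomicHerglotz S l z + 1) = u * z ^ 2 := by
  classical
  obtain ⟨w₁, w₂, h12, rfl⟩ := Finset.card_eq_two.1 hS
  have hl1 := hl w₁ (by simp)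
  have hl2 := hl w₂ (by simp)
  have hc := fun z hz => cayley_atomicHerglotz (fun w hw => (hl w hw).le) h1 h0 (z := z) hz
  simp only [Finset.sum_pair h12] at h1 h0 hc
  have hn : l w₁ = l w₂ := by
    have := congrArg norm (eq_neg_of_add_eq_zero_left h0)
    simpa [Circle.norm_coe, abs_of_pos hl1, abs_of_pos hl2] using this
  have hl' : (l w₂ : ℂ) ≠ 0 := by exact_mod_cast hl2.ne'
  have hw : (w₂ : ℂ) = -w₁ := by
    rw [hn] at h0
    have : (l w₂ : ℂ) * (w₁ + w₂) = 0 := by linear_combination h0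
    have := (mul_eq_zero.1 this).resolve_left hl'
    linear_combination this
  refine ⟨conj (w₁ : ℂ) ^ 2, by simp [Circle.norm_coe], fun z hz => ?_⟩
  obtain ⟨hne, hc⟩ := hc z hz
  rw [hc, mul_comm]
  congr 1
  rw [div_eq_iff hne]
  have d1 := circle_sub_ne_zero w₁ hz
  have d2 := circle_sub_ne_zero w₂ hz
  rw [hn, hw] at *
  field_simp
  simp only [map_neg]
  linear_combination (2 * w₁ * conj (w₁ : ℂ)) * circle_mul_conj w₁

/-- If `w₂ = -w₁`, then `w₃` is a real multiple of `w₁`, hence equal to `w₁` or `w₂`. -/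
theorem no_antipodal_points {w₁ w₂ w₃ : Circle} {l₁ l₂ l₃ : ℝ} (h13 : w₁ ≠ w₃) (h23 : w₂ ≠ w₃)
    (hl : 0 < l₃) (h0 : (l₁ : ℂ) * w₁ + l₂ * w₂ + l₃ * w₃ = 0) : (w₁ : ℂ) + w₂ ≠ 0 := by
  intro h
  have hw : (w₂ : ℂ) = -w₁ := by linear_combination h
  have hl' : (l₃ : ℂ) ≠ 0 := by exact_mod_cast hl.ne'
  have hc : (w₃ : ℂ) = (((l₂ - l₁) / l₃ : ℝ) : ℂ) * w₁ := by
    push_cast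
    field_simp
    rw [hw] at h0
    linear_combination h0
  have hn := congrArg norm hc
  rw [norm_mul, Circle.norm_coe, Circle.norm_coe, mul_one, Complex.norm_real,
    Real.norm_eq_abs] at hn
  rcases (abs_eq zero_le_one).1 hn.symm with h | h <;> rw [h] at hc
  · exact h13 (Circle.coe_injective (by simpa using hc.symm))
  · exact h23 (Circle.coe_injective (by rw [hw, hc]; simp))

/-- Here `vᵢ` stands for `conj wᵢ`. Keeping the two independent makes the relation symmetric, so it
also yields its own conjugate. -/
theorem sum_three_relation {v₁ v₂ v₃ w₁ w₂ w₃ l₁ l₂ l₃ : ℂ} (W₁ : w₁ * v₁ = 1) (W₂ : w₂ * v₂ = 1)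
    (W₃ : w₃ * v₃ = 1) (h1 : l₁ + l₂ + l₃ = 1) (h0 : l₁ * w₁ + l₂ * w₂ + l₃ * w₃ = 0)
    (h0' : l₁ * v₁ + l₂ * v₂ + l₃ * v₃ = 0) :
    l₁ * v₁ * w₂ * w₃ + l₂ * v₂ * w₁ * w₃ + l₃ * v₃ * w₁ * w₂ = -(w₁ + w₂ + w₃) := by
  linear_combination (w₁ * w₂ + w₁ * w₃ + w₂ * w₃) * h0' - (w₁ + w₂ + w₃) * h1 + h0
    - l₁ * (w₂ + w₃) * W₁ - l₂ * (w₁ + w₃) * W₂ - l₃ * (w₁ + w₂) * W₃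

/-- Over the common denominator `(w₁ - z)(w₂ - z)(w₃ - z)` the two sums in the Cayley transform have
numerators `z - a` and `w₁ w₂ w₃ (1 - conj(a) z)`, where `a` is the sum of the atoms. -/
theorem exists_cayley_atomicHerglotz_of_card_eq_three (hS : S.card = 3) (hl : ∀ w ∈ S, 0 < l w)
    (h1 : ∑ w ∈ S, l w = 1) (h0 : ∑ w ∈ S, (l w : ℂ) * w = 0) :
    ‖∑ w ∈ S, (w : ℂ)‖ < 1 ∧ ∃ u : ℂ, ‖u‖ = 1 ∧ ∀ z : ℂ, ‖z‖ < 1 →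
      (atomicHerglotz S l z - 1) / (atomicHerglotz S l z + 1) =
        u * cubicBlaschke (∑ w ∈ S, (w : ℂ)) z := by
  classical
  obtain ⟨w₁, w₂, w₃, h12, h13, h23, rfl⟩ := Finset.card_eq_three.1 hS
  have hl1 := hl w₁ (by simp)
  have hl2 := hl w₂ (by simp)
  have hl3 := hl w₃ (by simp)
  have hc := fun z hz => cayley_atomicHerglotz (fun w hw => (hl w hw).le) h1 h0 (z := z) hz
  have hsum : ∀ f : Circle → ℂ, ∑ w ∈ {w₁, w₂, w₃}, f w = f w₁ + f w₂ + f w₃ := fun f => by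
    rw [Finset.sum_insert (by simp [h12, h13]), Finset.sum_pair h23, add_assoc]
  have h1 : (l w₁ : ℂ) + l w₂ + l w₃ = 1 := by
    rw [← hsum fun w => (l w : ℂ)]
    exact_mod_cast h1
  simp only [hsum] at h0 hc ⊢
  have h0' := congrArg conj h0
  simp only [map_add, map_mul, Complex.conj_ofReal, map_zero] at h0'
  have W1 := circle_mul_conj w₁
  have W2 := circle_mul_conj w₂
  have W3 := circle_mul_conj w₃
  have key := sum_three_relation W1 W2 W3 h1 h0 h0'
  have key' := sum_three_relation ((mul_comm _ _).trans W1) ((mul_comm _ _).trans W2)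
    ((mul_comm _ _).trans W3) h1 h0' h0
  have n12 := no_antipodal_points h13 h23 hl3 h0
  have n13 := no_antipodal_points (l₃ := l w₂) h12 h23.symm hl2
    (by linear_combination h0 : (l w₁ : ℂ) * w₁ + l w₃ * w₃ + l w₂ * w₂ = 0)
  have n23 := no_antipodal_points (l₃ := l w₁) h12.symm h13.symm hl1
    (by linear_combination h0 : (l w₂ : ℂ) * w₂ + l w₃ * w₃ + l w₁ * w₁ = 0)
  -- By `key`, `-(w₁ + w₂ + w₃)` is a convex combination of unimodular numbers.
  have hle : ‖(w₁ : ℂ) + w₂ + w₃‖ ≤ 1 := by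
    rw [← norm_neg, ← key]
    refine (norm_add₃_le).trans ?_
    simp only [norm_mul, Complex.norm_conj, Circle.norm_coe, Complex.norm_real, mul_one,
      Real.norm_eq_abs, abs_of_pos, hl1, hl2, hl3]
    exact_mod_cast h1.le
  -- Equality would mean `e₁ e₂ = e₃` for the elementary symmetric functions, and `e₁ e₂ - e₃ = (w₁
  -- + w₂)(w₁ + w₃)(w₂ + w₃)`.
  have hlt : ‖(w₁ : ℂ) + w₂ + w₃‖ < 1 := by
    refine lt_of_le_of_ne hle fun he => mul_ne_zero (mul_ne_zero n12 n13) n23 ?_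
    have he2 : ((w₁ : ℂ) + w₂ + w₃) * conj ((w₁ : ℂ) + w₂ + w₃) = 1 := by
      rw [Complex.mul_conj, Complex.normSq_eq_norm_sq, he]; simp
    simp only [map_add] at he2
    linear_combination ((w₁ : ℂ) * w₂ * w₃) * he2
      - ((w₁ : ℂ) + w₂ + w₃) * (w₂ * w₃ * W1 + w₁ * w₃ * W2 + w₁ * w₂ * W3)
  refine ⟨hlt, conj ((w₁ : ℂ) * w₂ * w₃), by simp [Circle.norm_coe], fun z hz => ?_⟩
  obtain ⟨hne, hc⟩ := hc z hz
  have d1 := circle_sub_ne_zero w₁ hz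
  have d2 := circle_sub_ne_zero w₂ hz
  have d3 := circle_sub_ne_zero w₃ hz
  have d := one_sub_conj_mul_ne_zero hle hz
  have eA : (l w₁ : ℂ) * conj (w₁ : ℂ) / (w₁ - z) + l w₂ * conj (w₂ : ℂ) / (w₂ - z) +
      l w₃ * conj (w₃ : ℂ) / (w₃ - z) =
      (z - (w₁ + w₂ + w₃)) / ((w₁ - z) * (w₂ - z) * (w₃ - z)) := by
    rw [div_add_div _ _ d1 d2, div_add_div _ _ (mul_ne_zero d1 d2) d3]
    congr 1
    linear_combination key + z ^ 2 * h0' - z * ((w₁ : ℂ) + w₂ + w₃) * h0' + z * h1 +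
      z * (l w₁ * W1 + l w₂ * W2 + l w₃ * W3)
  have s : (l w₁ : ℂ) * w₁ ^ 2 + l w₂ * w₂ ^ 2 + l w₃ * w₃ ^ 2 =
      -(w₁ * w₂ * w₃) * conj ((w₁ : ℂ) + w₂ + w₃) := by
    simp only [map_add]
    linear_combination ((w₁ : ℂ) * w₂ * w₃) * key'
      - (l w₁ : ℂ) * w₁ ^ 2 * ((w₃ : ℂ) * conj (w₃ : ℂ) * W2 + W3)
      - (l w₂ : ℂ) * w₂ ^ 2 * ((w₃ : ℂ) * conj (w₃ : ℂ) * W1 + W3)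
      - (l w₃ : ℂ) * w₃ ^ 2 * ((w₂ : ℂ) * conj (w₂ : ℂ) * W1 + W2)
  have eB : (l w₁ : ℂ) * w₁ / (w₁ - z) + l w₂ * w₂ / (w₂ - z) + l w₃ * w₃ / (w₃ - z) =
      w₁ * w₂ * w₃ * (1 - conj ((w₁ : ℂ) + w₂ + w₃) * z) /
        ((w₁ - z) * (w₂ - z) * (w₃ - z)) := by
    rw [div_add_div _ _ d1 d2, div_add_div _ _ (mul_ne_zero d1 d2) d3]
    congr 1
    linear_combination z * s + ((w₁ : ℂ) * w₂ * w₃) * h1 + z ^ 2 * h0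
      - z * ((w₁ : ℂ) + w₂ + w₃) * h0
  rw [hc, eA, eB, cubicBlaschke, div_div_div_cancel_right₀ (mul_ne_zero (mul_ne_zero d1 d2) d3)]
  have p0 : (w₁ : ℂ) * w₂ * w₃ ≠ 0 := by simp
  have pp : (w₁ : ℂ) * w₂ * w₃ * conj ((w₁ : ℂ) * w₂ * w₃) = 1 := by
    rw [Complex.mul_conj, Complex.normSq_eq_norm_sq]; simp [Circle.norm_coe]
  rw [mul_div_assoc, mul_left_comm]
  congr 1
  rw [div_eq_iff (mul_ne_zero p0 d), mul_div_assoc', div_mul_eq_mul_div, eq_div_iff d]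
  linear_combination -(z - (w₁ + w₂ + w₃)) * (1 - conj ((w₁ : ℂ) + w₂ + w₃) * z) * pp

end Weights

/-! ### Description of the test functions -/

theorem integral_eq_sum_of_measure_compl_eq_zero {μ : Measure Circle} [IsFiniteMeasure μ]
    {S : Finset Circle} (hS : μ (S : Set Circle)ᶜ = 0) (f : Circle → ℂ) :
    ∫ w, f w ∂μ = ∑ w ∈ S, (μ.real {w} : ℂ) * f w := by
  have h : μ.restrict (S : Set Circle) = μ := Measure.restrict_eq_self_of_ae_mem hS
  conv_lhs => rw [← h]
  rw [setIntegral_finset S (IntegrableOn.finset)]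
  simp

theorem exists_atomicHerglotz_of_mem_thetaHat {μ : Measure Circle} (hμ : μ ∈ thetaHat) :
    ∃ (S : Finset Circle) (l : Circle → ℝ), (S.card = 2 ∨ S.card = 3) ∧ (∀ w ∈ S, 0 < l w) ∧
      ∑ w ∈ S, l w = 1 ∧ ∑ w ∈ S, (l w : ℂ) * w = 0 ∧
      ∀ z : Complex.UnitDisc, herglotz μ z = atomicHerglotz S l z := by
  obtain ⟨hp, h0, S, hc, hS, hpos⟩ := hμ
  refine ⟨S, fun w => μ.real {w}, hc, fun w hw => ?_, ?_, ?_, fun z => ?_⟩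
  · exact ENNReal.toReal_pos (hpos w hw).ne' (measure_ne_top _ _)
  · have := integral_eq_sum_of_measure_compl_eq_zero hS (fun _ => 1)
    simp only [integral_const, probReal_univ, one_smul, mul_one] at this
    exact_mod_cast this.symm
  · rw [← integral_eq_sum_of_measure_compl_eq_zero hS, h0]
  · exact integral_eq_sum_of_measure_compl_eq_zero hS _

theorem exists_mem_theta_of_weights {S : Finset Circle} {l : Circle → ℝ}
    (hc : S.card = 2 ∨ S.card = 3) (hl : ∀ w ∈ S, 0 < l w) (h1 : ∑ w ∈ S, l w = 1)
    (h0 : ∑ w ∈ S, (l w : ℂ) * w = 0) (hS : (-1 : Circle) ∈ S) :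
    ∃ μ ∈ theta, ∀ z : Complex.UnitDisc, herglotz μ z = atomicHerglotz S l z := by
  classical
  let μ : Measure Circle := ∑ w ∈ S, ENNReal.ofReal (l w) • Measure.dirac w
  have happ : ∀ s : Set Circle, μ s = ∑ w ∈ S, ENNReal.ofReal (l w) * Measure.dirac w s := by
    intro s
    simp [μ, Measure.finsetSum_apply]
  have hsing : ∀ w ∈ S, μ {w} = ENNReal.ofReal (l w) := by
    intro w hw
    rw [happ, Finset.sum_eq_single_of_mem w hw]
    · simp
    · intro v _ hv
      simp [hv]
  have hprob : IsProbabilityMeasure μ := by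
    refine ⟨?_⟩
    rw [happ]
    simp only [measure_univ, mul_one]
    rw [← ENNReal.ofReal_sum_of_nonneg (fun w hw => (hl w hw).le), h1, ENNReal.ofReal_one]
  have hcompl : μ (S : Set Circle)ᶜ = 0 := by
    rw [happ]
    refine Finset.sum_eq_zero fun w hw => ?_
    simp [hw]
  have hint : ∀ f : Circle → ℂ, ∫ w, f w ∂μ = ∑ w ∈ S, (l w : ℂ) * f w := by
    intro f
    rw [integral_eq_sum_of_measure_compl_eq_zero hcompl]
    refine Finset.sum_congr rfl fun w hw => ?_
    rw [Measure.real, hsing w hw, ENNReal.toReal_ofReal (hl w hw).le]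
  have hpos : ∀ w ∈ S, 0 < μ {w} := fun w hw => by
    rw [hsing w hw]
    exact ENNReal.ofReal_pos.2 (hl w hw)
  exact ⟨μ, ⟨⟨hprob, by rw [hint, h0], S, hc, hcompl, hpos⟩, hpos _ hS⟩, fun z => hint _⟩

/-- The other two points must sum to `1 + a = 2g (x + iy)` with `x + iy` unimodular, so they are `(x
+ iy)(g ± is)` with `g² + s² = 1`. The masses are the barycentric coordinates of `0` in the
resulting triangle. -/
theorem exists_three_weights {a : ℂ} (ha : ‖a‖ < 1) :
    ∃ (S : Finset Circle) (l : Circle → ℝ), S.card = 3 ∧ (-1 : Circle) ∈ S ∧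
      (∀ w ∈ S, 0 < l w) ∧ ∑ w ∈ S, l w = 1 ∧ ∑ w ∈ S, (l w : ℂ) * w = 0 ∧
      ∑ w ∈ S, (w : ℂ) = a := by
  classical
  have hsq : a.re * a.re + a.im * a.im < 1 := by
    rw [← Complex.normSq_apply, Complex.normSq_eq_norm_sq]
    nlinarith [norm_nonneg a]
  have hre : 0 < 1 + a.re := by nlinarith [sq_nonneg a.im, sq_nonneg (a.re + 1)]
  obtain ⟨r, hr, hr2⟩ : ∃ r : ℝ, 0 < r ∧ r ^ 2 = (1 + a.re) ^ 2 + a.im ^ 2 :=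
    ⟨√((1 + a.re) ^ 2 + a.im ^ 2), Real.sqrt_pos.2 (by positivity), Real.sq_sqrt (by positivity)⟩
  obtain ⟨x, hx⟩ : ∃ x : ℝ, x * r = 1 + a.re := ⟨(1 + a.re) / r, by field_simp⟩
  obtain ⟨y, hy⟩ : ∃ y : ℝ, y * r = a.im := ⟨a.im / r, by field_simp⟩
  obtain ⟨g, hg⟩ : ∃ g : ℝ, 2 * g = r := ⟨r / 2, by ring⟩
  have hg0 : 0 < g := by linarith
  have hxy : x ^ 2 + y ^ 2 = 1 := by
    have : (x ^ 2 + y ^ 2) * r ^ 2 = 1 * r ^ 2 := by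
      linear_combination (x * r + 1 + a.re) * hx + (y * r + a.im) * hy - hr2
    exact mul_right_cancel₀ (by positivity) this
  -- This is `|a| < 1` rewritten: `|a|² - 1 = r² - 2xr`.
  have hgx : g < x := by
    have : r * r < r * (2 * x) := by nlinarith
    have := lt_of_mul_lt_mul_left this hr.le
    linarith
  have hx1 : x ≤ 1 := by nlinarith [sq_nonneg y]
  obtain ⟨s, hs, hs2⟩ : ∃ s : ℝ, 0 < s ∧ g ^ 2 + s ^ 2 = 1 :=
    ⟨√(1 - g ^ 2), Real.sqrt_pos.2 (by nlinarith),
      by rw [Real.sq_sqrt (by nlinarith)]; ring⟩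
  -- The product equals `x² - g²`.
  have hprod : 0 < (x * s - y * g) * (x * s + y * g) := by nlinarith
  have hl2 : 0 < x * s - y * g := by
    by_contra h
    nlinarith [mul_pos (hg0.trans hgx) hs]
  have hl3 : 0 < x * s + y * g := pos_of_mul_pos_right hprod hl2.le
  have hT : 0 < 2 * g * s + 2 * x * s := by have := hg0.trans hgx; positivity
  have hpt : ∀ t : ℝ, t ^ 2 = s ^ 2 → ∃ w : Circle,
      (w : ℂ) = ((x : ℂ) + y * Complex.I) * (g + t * Complex.I) := by
    intro t ht
    refine ⟨⟨((x : ℂ) + y * Complex.I) * (g + t * Complex.I), ?_⟩, rfl⟩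
    refine mem_sphere_zero_iff_norm.2 ?_
    rw [norm_mul, Complex.norm_add_mul_I, Complex.norm_add_mul_I, hxy,
      ht, hs2]
    simp
  obtain ⟨w₂, hw2⟩ := hpt s rfl
  obtain ⟨w₃, hw3⟩ := hpt (-s) (by ring)
  have hsumw : (-1 : ℂ) + w₂ + w₃ = a := by
    rw [hw2, hw3]
    apply Complex.ext <;> simp <;> nlinarith
  -- A second atom at `-1` would give `|a| ≥ 1`.
  have hfar : ∀ w : Circle, (-1 : ℂ) + -1 + w ≠ a := by
    intro w hw
    have h2 : ‖(-1 : ℂ) + -1‖ ≤ ‖a‖ + ‖(w : ℂ)‖ := by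
      rw [← hw]
      simpa using norm_sub_le ((-1 : ℂ) + -1 + w) w
    rw [Circle.norm_coe] at h2
    norm_num at h2
    linarith
  have h12 : (-1 : Circle) ≠ w₂ := by
    intro h
    have : (w₂ : ℂ) = -1 := by rw [← h]; simp
    rw [this] at hsumw
    exact hfar _ hsumw
  have h13 : (-1 : Circle) ≠ w₃ := by
    intro h
    have : (w₃ : ℂ) = -1 := by rw [← h]; simp
    rw [this] at hsumw
    exact hfar w₂ (by rw [← hsumw]; ring)
  have h23 : w₂ ≠ w₃ := by
    intro h
    have h := congrArg (fun w : Circle => (w : ℂ)) h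
    simp only [hw2, hw3] at h
    have e1 := congrArg Complex.re h
    have e2 := congrArg Complex.im h
    simp at e1 e2
    have : 0 < x * s := mul_pos (hg0.trans hgx) hs
    linarith
  set T := 2 * g * s + 2 * x * s
  let l : Circle → ℝ := fun w =>
    if w = w₂ then (x * s - y * g) / T else if w = w₃ then (x * s + y * g) / T else 2 * g * s / T
  have e1 : l (-1) = 2 * g * s / T := by simp [l, h12, h13]
  have e2 : l w₂ = (x * s - y * g) / T := by simp [l]
  have e3 : l w₃ = (x * s + y * g) / T := by simp [l, h23.symm]
  have hsumR : ∀ f : Circle → ℝ, ∑ w ∈ {-1, w₂, w₃}, f w = f (-1) + f w₂ + f w₃ := fun f => by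
    rw [Finset.sum_insert (by simp [h12, h13]), Finset.sum_pair h23, add_assoc]
  have hsumC : ∀ f : Circle → ℂ, ∑ w ∈ {-1, w₂, w₃}, f w = f (-1) + f w₂ + f w₃ := fun f => by
    rw [Finset.sum_insert (by simp [h12, h13]), Finset.sum_pair h23, add_assoc]
  refine ⟨{-1, w₂, w₃}, l, Finset.card_eq_three.2 ⟨_, _, _, h12, h13, h23, rfl⟩, by simp, ?_,
    ?_, ?_, ?_⟩
  · intro w hw
    simp only [Finset.mem_insert, Finset.mem_singleton] at hw
    rcases hw with rfl | rfl | rfl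
    · rw [e1]; positivity
    · rw [e2]; positivity
    · rw [e3]; positivity
  · rw [hsumR, e1, e2, e3]
    field_simp
    simp only [T]
    ring
  · rw [hsumC, e1, e2, e3, hw2, hw3]
    have hT' : (T : ℂ) ≠ 0 := by exact_mod_cast hT.ne'
    push_cast
    field_simp
    have c1 : (x : ℂ) ^ 2 + y ^ 2 = 1 := by exact_mod_cast hxy
    linear_combination (2 * g * s : ℂ) * c1 - 2 * (y : ℂ) ^ 2 * g * s * Complex.I_sq
  · rw [hsumC]
    simpa using hsumw

theorem exists_antipodal_weights :
    ∃ (S : Finset Circle) (l : Circle → ℝ), S.card = 2 ∧ (-1 : Circle) ∈ S ∧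
      (∀ w ∈ S, 0 < l w) ∧ ∑ w ∈ S, l w = 1 ∧ ∑ w ∈ S, (l w : ℂ) * w = 0 := by
  classical
  have h : (-1 : Circle) ≠ 1 := by
    intro h
    have := congrArg (fun w : Circle => (w : ℂ).re) h
    norm_num at this
  refine ⟨{-1, 1}, fun _ => 1 / 2, Finset.card_pair h, by simp, by simp, ?_, ?_⟩
  · rw [Finset.sum_pair h]; norm_num
  · rw [Finset.sum_pair h]; simp

theorem eq_sq_or_eq_cubicBlaschke_of_mem_testFamily {ψ : Complex.UnitDisc → ℂ}
    (hψ : ψ ∈ testFamily) : ∃ u : ℂ, ‖u‖ = 1 ∧ ((ψ = fun z : Complex.UnitDisc => u * (z : ℂ) ^ 2) ∨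
      ∃ a : ℂ, ‖a‖ < 1 ∧ ψ = fun z : Complex.UnitDisc => u * cubicBlaschke a z) := by
  obtain ⟨μ, hμ, rfl⟩ := hψ
  obtain ⟨S, l, hc, hl, h1, h0, hh⟩ := exists_atomicHerglotz_of_mem_thetaHat hμ.1
  rcases hc with hc | hc
  · obtain ⟨u, hu, h⟩ := exists_cayley_atomicHerglotz_of_card_eq_two hc hl h1 h0
    exact ⟨u, hu, Or.inl (funext fun z => by rw [testFunction, hh, h z z.norm_lt_one])⟩
  · obtain ⟨ha, u, hu, h⟩ := exists_cayley_atomicHerglotz_of_card_eq_three hc hl h1 h0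
    exact ⟨u, hu, Or.inr ⟨_, ha, funext fun z => by rw [testFunction, hh, h z z.norm_lt_one]⟩⟩

theorem exists_sq_mem_testFamily :
    ∃ u : ℂ, ‖u‖ = 1 ∧ (fun z : Complex.UnitDisc => u * (z : ℂ) ^ 2) ∈ testFamily := by
  obtain ⟨S, l, hc, hS, hl, h1, h0⟩ := exists_antipodal_weights
  obtain ⟨u, hu, h⟩ := exists_cayley_atomicHerglotz_of_card_eq_two hc hl h1 h0
  obtain ⟨μ, hμ, hh⟩ := exists_mem_theta_of_weights (Or.inl hc) hl h1 h0 hS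
  exact ⟨u, hu, μ, hμ, funext fun z => by rw [testFunction, hh, h z z.norm_lt_one]⟩

theorem exists_cubicBlaschke_mem_testFamily {a : ℂ} (ha : ‖a‖ < 1) :
    ∃ u : ℂ, ‖u‖ = 1 ∧ (fun z : Complex.UnitDisc => u * cubicBlaschke a z) ∈ testFamily := by
  obtain ⟨S, l, hc, hS, hl, h1, h0, rfl⟩ := exists_three_weights ha
  obtain ⟨-, u, hu, h⟩ := exists_cayley_atomicHerglotz_of_card_eq_three hc hl h1 h0
  obtain ⟨μ, hμ, hh⟩ := exists_mem_theta_of_weights (Or.inr hc) hl h1 h0 hS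
  exact ⟨u, hu, μ, hμ, funext fun z => by rw [testFunction, hh, h z z.norm_lt_one]⟩

/-- A kernel that is admissible for the test functions makes the Herglotz transform of every
zero-mean measure with two or three atoms positive. -/
theorem isPositiveKernel_re_atomicHerglotz {k : Complex.UnitDisc → Complex.UnitDisc → ℂ}
    (hk : k ∈ kernels testFamily) {S : Finset Circle} {l : Circle → ℝ}
    (hc : S.card = 2 ∨ S.card = 3) (hl : ∀ w ∈ S, 0 < l w) (h1 : ∑ w ∈ S, l w = 1)
    (h0 : ∑ w ∈ S, (l w : ℂ) * w = 0) :
    IsPositiveKernel (fun x y : Complex.UnitDisc =>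
      (atomicHerglotz S l x + conj (atomicHerglotz S l y)) * k x y) := by
  rw [← isPositiveKernel_pickKernel_cayley (h := fun z : Complex.UnitDisc => atomicHerglotz S l z)
    (fun z => atomicHerglotz_add_one_ne_zero (fun w hw => (hl w hw).le) z.norm_lt_one)]
  -- `S` need not contain `-1`; the family contains a unimodular multiple of the same function,
  -- which has the same Pick kernel.
  rcases hc with hc | hc
  · obtain ⟨u, hu, h⟩ := exists_cayley_atomicHerglotz_of_card_eq_two hc hl h1 h0
    obtain ⟨v, hv, hmem⟩ := exists_sq_mem_testFamily
    have := hk.2 _ hmem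
    rw [pickKernel_unimodular_mul hv] at this
    rw [funext fun z : Complex.UnitDisc => h z z.norm_lt_one, pickKernel_unimodular_mul hu]
    exact this
  · obtain ⟨ha, u, hu, h⟩ := exists_cayley_atomicHerglotz_of_card_eq_three hc hl h1 h0
    obtain ⟨v, hv, hmem⟩ := exists_cubicBlaschke_mem_testFamily ha
    have := hk.2 _ hmem
    rw [pickKernel_unimodular_mul hv] at this
    rw [funext fun z : Complex.UnitDisc => h z z.norm_lt_one, pickKernel_unimodular_mul hu]
    exact this

/-! ### The kernel `1 + x² ȳ² / (1 - x ȳ)` -/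

theorem conj_mul_coe_ne_one (x y : Complex.UnitDisc) : 1 - (x : ℂ) * conj (y : ℂ) ≠ 0 := by
  rw [mul_comm]
  exact one_sub_conj_mul_ne_zero y.norm_lt_one.le x.norm_lt_one

theorem differentiableOn_tsum_mul_pow {c : ℕ → ℂ} {M : ℝ} (hc : ∀ n, ‖c n‖ ≤ M) :
    DifferentiableOn ℂ (fun z : ℂ => ∑' n, c n * z ^ n) (Metric.ball 0 1) := by
  intro z hz
  rw [mem_ball_zero_iff] at hz
  obtain ⟨r, hzr, hr⟩ := exists_between hz
  have hr0 : 0 ≤ r := (norm_nonneg z).trans hzr.le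
  have h : DifferentiableOn ℂ (fun z : ℂ => ∑' n, c n * z ^ n) (Metric.ball 0 r) := by
    refine Complex.differentiableOn_tsum_of_summable_norm
      ((summable_geometric_of_lt_one hr0 hr).mul_left M) (fun n => by fun_prop)
      Metric.isOpen_ball fun n w hw => ?_
    rw [mem_ball_zero_iff] at hw
    rw [norm_mul, norm_pow]
    have := (norm_nonneg _).trans (hc n)
    gcongr
    exact hc n
  exact (h.differentiableAt (Metric.isOpen_ball.mem_nhds
    (mem_ball_zero_iff.2 hzr))).differentiableWithinAt

/-- The exponents `0, 2, 3, …`. -/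
def gapExponent : ℕ → ℕ
  | 0 => 0
  | n + 1 => n + 2

theorem le_gapExponent (n : ℕ) : n ≤ gapExponent n := by
  cases n <;> simp [gapExponent]

theorem memℓp_gapVector (x : Complex.UnitDisc) :
    Memℓp (fun n => conj (x : ℂ) ^ gapExponent n) 2 := by
  rw [memℓp_gen_iff (by norm_num)]
  have hx := x.norm_lt_one
  refine Summable.of_nonneg_of_le (fun n => by positivity) (fun n => ?_)
    (summable_geometric_of_lt_one (norm_nonneg (x : ℂ)) hx)
  simp only [norm_pow, Complex.norm_conj, ENNReal.toReal_ofNat, Real.rpow_ofNat]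
  rw [← pow_mul]
  exact pow_le_pow_of_le_one (norm_nonneg _) hx.le
    ((le_gapExponent n).trans (Nat.le_mul_of_pos_right _ two_pos))

theorem inner_self_eq_ofReal_norm_sq {H : Type*} [NormedAddCommGroup H] [InnerProductSpace ℂ H]
    (v : H) : inner ℂ v v = ((‖v‖ ^ 2 : ℝ) : ℂ) :=
  (inner_self_eq_norm_sq_to_K v).trans (Complex.ofReal_pow _ _).symm

/-- The vector `(1, x̄², x̄³, …)` of `ℓ²`. -/
noncomputable def gapVector (x : Complex.UnitDisc) : lp (fun _ : ℕ => ℂ) 2 :=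
  ⟨fun n => conj (x : ℂ) ^ gapExponent n, memℓp_gapVector x⟩

/-- The reproducing kernel of the functions in the Hardy space with vanishing derivative at `0`. -/
noncomputable def gapKernel (x y : Complex.UnitDisc) : ℂ :=
  inner ℂ (gapVector x) (gapVector y)

theorem gapKernel_eq (x y : Complex.UnitDisc) :
    gapKernel x y = 1 + ((x : ℂ) * conj (y : ℂ)) ^ 2 / (1 - x * conj (y : ℂ)) := by
  have ht : ‖(x : ℂ) * conj (y : ℂ)‖ < 1 := by
    rw [norm_mul, Complex.norm_conj]
    exact mul_lt_one_of_nonneg_of_lt_one_left (norm_nonneg _) x.norm_lt_one y.norm_lt_one.le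
  have hs : HasSum (fun n => ((x : ℂ) * conj (y : ℂ)) ^ gapExponent (n + 1))
      (((x : ℂ) * conj (y : ℂ)) ^ 2 * (1 - x * conj (y : ℂ))⁻¹) := by
    have e : (fun n => ((x : ℂ) * conj (y : ℂ)) ^ gapExponent (n + 1)) =
        fun n => ((x : ℂ) * conj (y : ℂ)) ^ 2 * ((x : ℂ) * conj (y : ℂ)) ^ n := by
      funext n
      simp only [gapExponent]
      ring
    rw [e]
    exact (hasSum_geometric_of_norm_lt_one ht).mul_left _
  rw [gapKernel, lp.inner_eq_tsum, div_eq_mul_inv]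
  have he : ∀ n, inner ℂ (gapVector x n) (gapVector y n) =
      ((x : ℂ) * conj (y : ℂ)) ^ gapExponent n := by
    intro n
    simp [gapVector, mul_pow, mul_comm]
  simp_rw [he]
  rw [((hasSum_nat_add_iff' 1).1 (by simpa [gapExponent] using hs) : HasSum _
    (1 + ((x : ℂ) * conj (y : ℂ)) ^ 2 * (1 - x * conj (y : ℂ))⁻¹)).tsum_eq]

/-- Multiplication by a test function is isometric on the space of `gapKernel`, so its Pick kernel
is the reproducing kernel of the complement of the range. Orthonormal bases of that complement are
`1, z³` for `z²`, and, with `b = (z - a) / (1 - conj(a) z)`, the functions `1`, `√(1 - |a|²) z² / (1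
- conj(a) z)`, `z³ b` for `z² b`. -/
theorem gapKernel_mem_kernels : gapKernel ∈ kernels testFamily := by
  refine ⟨isPositiveKernel_inner gapVector, fun ψ hψ => ?_⟩
  obtain ⟨u, hu, rfl | ⟨a, ha, rfl⟩⟩ := eq_sq_or_eq_cubicBlaschke_of_mem_testFamily hψ
  · rw [pickKernel_unimodular_mul hu]
    convert (isPositiveKernel_mul_conj (fun _ : Complex.UnitDisc => (1 : ℂ))).add
      (isPositiveKernel_mul_conj (fun z : Complex.UnitDisc => (z : ℂ) ^ 3)) using 3 with x y
    have := conj_mul_coe_ne_one x y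
    rw [pickKernel, gapKernel_eq]
    simp only [map_pow, map_one]
    field_simp
    ring
  · rw [pickKernel_unimodular_mul hu]
    have ha2 : 0 ≤ 1 - ‖a‖ ^ 2 := by nlinarith [norm_nonneg a]
    convert ((isPositiveKernel_mul_conj (fun _ : Complex.UnitDisc => (1 : ℂ))).add
      (isPositiveKernel_mul_conj (fun z : Complex.UnitDisc =>
        ((√(1 - ‖a‖ ^ 2) : ℝ) : ℂ) * ((z : ℂ) ^ 2 / (1 - conj a * z))))).add
      (isPositiveKernel_mul_conj (fun z : Complex.UnitDisc =>
        (z : ℂ) ^ 3 * (z - a) / (1 - conj a * z))) using 3 with x y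
    have h1 := conj_mul_coe_ne_one x y
    have h2 := one_sub_conj_mul_ne_zero ha.le x.norm_lt_one
    have h2' := h2
    rw [mul_comm] at h2'
    have h3 := one_sub_conj_mul_ne_zero ha.le y.norm_lt_one
    have h3' : 1 - a * conj (y : ℂ) ≠ 0 := fun h => h3 (by
      have := congrArg conj h
      simpa using this)
    have hsq : ((√(1 - ‖a‖ ^ 2) : ℝ) : ℂ) ^ 2 = 1 - a * conj a := by
      rw [← Complex.ofReal_pow, Real.sq_sqrt ha2, Complex.mul_conj, Complex.normSq_eq_norm_sq]
      push_cast
      ring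
    rw [pickKernel, gapKernel_eq]
    simp only [cubicBlaschke, map_pow, map_one, map_mul, map_div₀, map_sub, Complex.conj_conj,
      Complex.conj_ofReal]
    have hsq' : ∀ p q : ℂ, ((√(1 - ‖a‖ ^ 2) : ℝ) : ℂ) * p * (((√(1 - ‖a‖ ^ 2) : ℝ) : ℂ) * q) =
        (1 - a * conj a) * p * q := fun p q => by rw [← hsq]; ring
    rw [hsq']
    field_simp
    ring

/-- The bound lets `φ` descend to the range of `A`; Hahn–Banach and Riesz then apply. With `M` the
formal combinations of points, independence of the kernel vectors is never needed. -/
theorem exists_inner_eq_of_norm_le {M H : Type*} [AddCommGroup M] [Module ℂ M]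
    [NormedAddCommGroup H] [InnerProductSpace ℂ H] [CompleteSpace H] (A : M →ₗ[ℂ] H)
    (φ : M →ₗ[ℂ] ℂ) (h : ∀ m, ‖φ m‖ ≤ ‖A m‖) : ∃ g : H, ∀ m, φ m = inner ℂ g (A m) := by
  have hker : LinearMap.ker A ≤ LinearMap.ker φ := fun m hm => by
    have := h m
    rw [LinearMap.mem_ker.1 hm, norm_zero] at this
    exact norm_le_zero_iff.1 this
  let φ' : LinearMap.range A →ₗ[ℂ] ℂ :=
    (LinearMap.ker A).liftQ φ hker ∘ₗ A.quotKerEquivRange.symm.toLinearMap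
  have hφ' : ∀ m, φ' ⟨A m, m, rfl⟩ = φ m := by
    intro m
    have : A.quotKerEquivRange.symm ⟨A m, m, rfl⟩ = (LinearMap.ker A).mkQ m := by
      rw [LinearEquiv.symm_apply_eq]
      rfl
    simp only [φ', LinearMap.comp_apply, LinearEquiv.coe_coe, this, Submodule.mkQ_apply,
      Submodule.liftQ_apply]
  let ψ : StrongDual ℂ (LinearMap.range A) := φ'.mkContinuous 1 (by
    rintro ⟨_, m, rfl⟩
    rw [hφ', one_mul]
    exact h m)
  obtain ⟨Ψ, hΨ, -⟩ := exists_extension_norm_eq (LinearMap.range A) ψ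
  refine ⟨(InnerProductSpace.toDual ℂ H).symm Ψ, fun m => ?_⟩
  rw [InnerProductSpace.toDual_symm_apply, ← hφ' m]
  exact (hΨ ⟨A m, m, rfl⟩).symm

theorem norm_le_one_of_isPositiveKernel_pickKernel {f : Complex.UnitDisc → ℂ}
    (hf : IsPositiveKernel (pickKernel f gapKernel)) (z : Complex.UnitDisc) : ‖f z‖ ≤ 1 := by
  have h := hf.diag_nonneg z
  have hv : gapVector z ≠ 0 := by
    intro h
    have := congrArg (fun v : lp (fun _ : ℕ => ℂ) 2 => v 0) h
    simp [gapVector, gapExponent] at this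
  have hpos : 0 < ‖gapVector z‖ ^ 2 := by positivity
  rw [pickKernel, gapKernel, inner_self_eq_ofReal_norm_sq, Complex.mul_conj,
    Complex.normSq_eq_norm_sq] at h
  have h' : 0 ≤ (1 - ‖f z‖ ^ 2) * ‖gapVector z‖ ^ 2 := by exact_mod_cast h
  have := nonneg_of_mul_nonneg_left h' hpos
  nlinarith [norm_nonneg (f z)]

/-- The quadratic form of the Pick kernel is the difference of the two squared norms. -/
theorem norm_linearCombination_gapVector_le {f : Complex.UnitDisc → ℂ}
    (hf : IsPositiveKernel (pickKernel f gapKernel)) (c : Complex.UnitDisc →₀ ℂ) :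
    ‖Finsupp.linearCombination ℂ (fun x => conj (f x) • gapVector x) c‖ ≤
      ‖Finsupp.linearCombination ℂ gapVector c‖ := by
  have h := (isPositiveKernel_iff.1 hf).2 c.support c
  have key : ∀ v : Complex.UnitDisc → lp (fun _ : ℕ => ℂ) 2,
      ((‖Finsupp.linearCombination ℂ v c‖ ^ 2 : ℝ) : ℂ) =
        ∑ x ∈ c.support, ∑ y ∈ c.support, conj (c x) * inner ℂ (v x) (v y) * c y := by
    intro v
    rw [← inner_self_eq_ofReal_norm_sq, Finsupp.linearCombination_apply, Finsupp.sum, sum_inner]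
    refine Finset.sum_congr rfl fun x _ => ?_
    rw [inner_sum]
    refine Finset.sum_congr rfl fun y _ => ?_
    rw [inner_smul_left, inner_smul_right]
    ring
  have h2 : ∑ x ∈ c.support, ∑ y ∈ c.support, conj (c x) * pickKernel f gapKernel x y * c y =
      ((‖Finsupp.linearCombination ℂ gapVector c‖ ^ 2 : ℝ) : ℂ) -
      ((‖Finsupp.linearCombination ℂ (fun x => conj (f x) • gapVector x) c‖ ^ 2 : ℝ) : ℂ) := by
    rw [key, key, ← Finset.sum_sub_distrib]
    refine Finset.sum_congr rfl fun x _ => ?_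
    rw [← Finset.sum_sub_distrib]
    refine Finset.sum_congr rfl fun y _ => ?_
    rw [inner_smul_left, inner_smul_right, pickKernel, gapKernel, Complex.conj_conj]
    ring
  rw [h2, ← Complex.ofReal_sub, Complex.zero_le_real, sub_nonneg] at h
  exact (sq_le_sq₀ (norm_nonneg _) (norm_nonneg _)).1 h

theorem gapKernel_zero_left (x : Complex.UnitDisc) : gapKernel 0 x = 1 := by
  simp [gapKernel_eq]

/-- A function whose Pick kernel with respect to `gapKernel` is positive belongs to
`H₁^∞(𝔻)`. -/
theorem mem_hInftyOne_of_isPositiveKernel_pickKernel {f : Complex.UnitDisc → ℂ}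
    (hf : IsPositiveKernel (pickKernel f gapKernel)) : f ∈ hInftyOne := by
  refine ⟨?_, 1, norm_le_one_of_isPositiveKernel_pickKernel hf⟩
  have h0 : ‖gapVector 0‖ = 1 := by
    have h := gapKernel_zero_left 0
    rw [gapKernel, inner_self_eq_ofReal_norm_sq] at h
    have : ‖gapVector 0‖ ^ 2 = 1 := by exact_mod_cast h
    nlinarith [norm_nonneg (gapVector 0)]
  obtain ⟨g, hg⟩ := exists_inner_eq_of_norm_le (Finsupp.linearCombination ℂ gapVector)
    (Finsupp.linearCombination ℂ fun x => conj (f x)) (fun c => by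
      have e : Finsupp.linearCombination ℂ (fun x => conj (f x)) c = inner ℂ (gapVector 0)
          (Finsupp.linearCombination ℂ (fun x => conj (f x) • gapVector x) c) := by
        rw [Finsupp.linearCombination_apply, Finsupp.linearCombination_apply, Finsupp.sum,
          Finsupp.sum, inner_sum]
        refine Finset.sum_congr rfl fun x _ => ?_
        rw [inner_smul_right, inner_smul_right, ← gapKernel, gapKernel_zero_left, mul_one,
          smul_eq_mul]
      rw [e]
      refine (norm_inner_le_norm _ _).trans ?_
      rw [h0, one_mul]
      exact norm_linearCombination_gapVector_le hf c)
  have hdiff := differentiableOn_tsum_mul_pow (c := fun n => g (n + 1)) (M := ‖g‖)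
    fun n => lp.norm_apply_le_norm two_ne_zero g (n + 1)
  have h0mem : (0 : ℂ) ∈ Metric.ball (0 : ℂ) 1 := by simp
  -- The expansion of `⟪gapVector z, g⟫`, with the missing exponent 1 visible in the factor `z²`.
  refine ⟨fun z => g 0 + z ^ 2 * ∑' n, g (n + 1) * z ^ n, fun z => ?_, ?_, ?_⟩
  · have h := hg (Finsupp.single z 1)
    simp only [Finsupp.linearCombination_single, one_smul] at h
    have h' := congrArg conj h
    rw [Complex.conj_conj, inner_conj_symm, lp.inner_eq_tsum] at h'
    have hs : Summable fun n => inner ℂ (gapVector z n) (g n) := lp.summable_inner _ _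
    rw [h', hs.tsum_eq_zero_add]
    dsimp only
    rw [← tsum_mul_left]
    simp only [gapVector, gapExponent, RCLike.inner_apply, map_pow, Complex.conj_conj]
    congr 1
    · simp
    · refine tsum_congr fun n => ?_
      ring
  · exact (differentiableOn_const _).add ((differentiableOn_id.pow 2).mul hdiff)
  · have hd := (hdiff.differentiableAt (Metric.isOpen_ball.mem_nhds h0mem)).hasDerivAt
    have := (((hasDerivAt_id (0 : ℂ)).pow 2).mul hd).const_add (g 0)
    simpa using this.deriv

/-! ### Zero-mean measures on the circle and their extreme points -/

/-- If a function has nonnegative integral against every zero-mean measure carried by exactly two or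
three points of the circle, then so it has against every finitely supported zero-mean measure. -/
theorem sum_mul_nonneg_of_two_or_three_points {φ : ℂ → ℝ}
    (h : ∀ (S : Finset Circle) (l : Circle → ℝ), (S.card = 2 ∨ S.card = 3) → (∀ w ∈ S, 0 < l w) →
      ∑ w ∈ S, (l w : ℂ) * w = 0 → 0 ≤ ∑ w ∈ S, l w * φ w)
    (S : Finset Circle) (l : Circle → ℝ) (hl : ∀ w ∈ S, 0 ≤ l w)
    (h0 : ∑ w ∈ S, (l w : ℂ) * w = 0) : 0 ≤ ∑ w ∈ S, l w * φ w := by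
  classical
  induction hn : S.card using Nat.strong_induction_on generalizing S l with
  | _ n ih =>
  subst hn
  by_cases hz : ∃ w ∈ S, l w = 0
  · obtain ⟨w, hw, hw0⟩ := hz
    rw [← Finset.sum_erase (f := fun w : Circle => l w * φ w) S (a := w) (by simp [hw0])]
    refine ih _ (Finset.card_erase_lt_of_mem hw) _ l
      (fun v hv => hl v (Finset.mem_of_mem_erase hv)) ?_ rfl
    rw [Finset.sum_erase _ (by simp [hw0]), h0]
  push Not at hz
  have hpos : ∀ w ∈ S, 0 < l w := fun w hw => (hl w hw).lt_of_ne' (hz w hw)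
  rcases Nat.lt_or_ge S.card 4 with hc | hc
  · interval_cases hcard : S.card
    · simp [Finset.card_eq_zero.1 hcard]
    · obtain ⟨w, rfl⟩ := Finset.card_eq_one.1 hcard
      have := hpos w (by simp)
      simp [this.ne'] at h0
    · exact h S l (Or.inl hcard) hpos h0
    · exact h S l (Or.inr hcard) hpos h0
  -- Four points in the real plane are affinely dependent: some nonzero perturbation of the masses
  -- keeps both total mass and mean.
  · have hcardT : (S.map ⟨fun w : Circle => (w : ℂ), Circle.coe_injective⟩).card = S.card :=
      Finset.card_map _
    obtain ⟨d, hd0, hd1, hdne⟩ :=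
      Module.exists_nontrivial_relation_sum_zero_of_finrank_succ_lt_card (R := ℝ)
      (t := S.map ⟨fun w : Circle => (w : ℂ), Circle.coe_injective⟩)
      (by rw [hcardT, Complex.finrank_real_complex]; omega)
    rw [Finset.sum_map] at hd0 hd1
    replace hd0 : ∑ w ∈ S, d (w : ℂ) • (w : ℂ) = 0 := hd0
    replace hd1 : ∑ w ∈ S, d (w : ℂ) = 0 := hd1
    obtain ⟨_, hx, hd⟩ := hdne
    obtain ⟨w₀, hw₀, rfl⟩ := Finset.mem_map.1 hx
    replace hd : d (w₀ : ℂ) ≠ 0 := hd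
    -- The sign is chosen so that subtracting multiples of `c` cannot increase the integral of `φ`.
    obtain ⟨c, hc0, hc1, hcφ, w₁, hw₁, hcw₁⟩ : ∃ c : Circle → ℝ, ∑ w ∈ S, (c w : ℂ) * w = 0 ∧
        ∑ w ∈ S, c w = 0 ∧ 0 ≤ ∑ w ∈ S, c w * φ w ∧ ∃ w ∈ S, c w ≠ 0 := by
      rcases le_total 0 (∑ w ∈ S, d w * φ w) with hs | hs
      · exact ⟨fun w => d w, by simpa using hd0, hd1, hs, w₀, hw₀, hd⟩
      · refine ⟨fun w => -d w, ?_, ?_, ?_, w₀, hw₀, neg_ne_zero.2 hd⟩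
        · simpa using hd0
        · simpa using hd1
        · simpa using hs
    obtain ⟨w₂, hw₂, hcw₂⟩ := Finset.exists_pos_of_sum_zero_of_exists_nonzero c hc1
      ⟨w₁, hw₁, hcw₁⟩
    -- The minimal ratio is the largest multiple of `c` that leaves all masses nonnegative; it kills
    -- the atom `v`.
    obtain ⟨v, hv, hmin⟩ := (S.filter fun w => 0 < c w).exists_min_image (fun w => l w / c w)
      ⟨w₂, Finset.mem_filter.2 ⟨hw₂, hcw₂⟩⟩
    obtain ⟨hvS, hcv⟩ := Finset.mem_filter.1 hv
    set t := l v / c v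
    have ht : 0 ≤ t := div_nonneg (hl v hvS) hcv.le
    have hv0 : l v - t * c v = 0 := by simp [t, hcv.ne']
    have key := ih _ (Finset.card_erase_lt_of_mem hvS) (S.erase v) (fun w => l w - t * c w)
      (fun w hw => ?_) ?_ rfl
    · rw [Finset.sum_erase _ (by simp [hv0])] at key
      have : ∑ w ∈ S, (l w - t * c w) * φ w = ∑ w ∈ S, l w * φ w - t * ∑ w ∈ S, c w * φ w := by
        rw [Finset.mul_sum, ← Finset.sum_sub_distrib]
        exact Finset.sum_congr rfl fun w _ => by ring
      have := mul_nonneg ht hcφ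
      linarith
    · have hwS := Finset.mem_of_mem_erase hw
      rcases le_or_gt (c w) 0 with hcw | hcw
      · nlinarith [hl w hwS]
      · have := hmin w (Finset.mem_filter.2 ⟨hwS, hcw⟩)
        rw [le_div_iff₀ hcw] at this
        linarith
    · rw [Finset.sum_erase _ (by rw [hv0]; simp)]
      have : ∑ w ∈ S, ((l w - t * c w : ℝ) : ℂ) * w =
          ∑ w ∈ S, (l w : ℂ) * w - t * ∑ w ∈ S, (c w : ℂ) * w := by
        rw [Finset.mul_sum, ← Finset.sum_sub_distrib]
        exact Finset.sum_congr rfl fun w _ => by push_cast; ring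
      rw [this, h0, hc0]
      simp

/-- The moments `(∫ w dμ, ∫ φ dμ)` of the finitely supported measures `μ` on the circle. -/
def atomicMoments (φ : ℂ → ℝ) : Set (ℂ × ℝ) :=
  Finsupp.linearCombination ℝ (fun w : Circle => ((w : ℂ), φ w)) '' {l | 0 ≤ l}

theorem convex_atomicMoments (φ : ℂ → ℝ) : Convex ℝ (atomicMoments φ) := by
  refine Convex.linear_image ?_ _
  exact convex_Ici (𝕜 := ℝ) (0 : Circle →₀ ℝ)

/-- An extra atom of mass `‖m‖` at `-m / ‖m‖` cancels the mean `m` and raises the `φ`-moment by at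
most `C ‖m‖`. Unlike the hypothesis on zero-mean measures alone, this bound passes to the closure.
-/
theorem neg_mul_norm_le_of_mem_atomicMoments {φ : ℂ → ℝ} {C : ℝ} (hC : ∀ w : Circle, φ w ≤ C)
    (h : ∀ (S : Finset Circle) (l : Circle → ℝ), (∀ w ∈ S, 0 ≤ l w) →
      ∑ w ∈ S, (l w : ℂ) * w = 0 → 0 ≤ ∑ w ∈ S, l w * φ w) {p : ℂ × ℝ}
    (hp : p ∈ atomicMoments φ) : -(C * ‖p.1‖) ≤ p.2 := by
  classical
  obtain ⟨l, hl, rfl⟩ := hp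
  have hsum : ∀ l : Circle →₀ ℝ, 0 ≤ l →
      (Finsupp.linearCombination ℝ (fun w : Circle => ((w : ℂ), φ w)) l).1 = 0 →
      0 ≤ (Finsupp.linearCombination ℝ (fun w : Circle => ((w : ℂ), φ w)) l).2 := by
    intro l hl h0
    rw [Finsupp.linearCombination_apply, Finsupp.sum] at h0 ⊢
    rw [Prod.fst_sum] at h0
    rw [Prod.snd_sum]
    exact h l.support l (fun w _ => hl w) (by simpa using h0)
  set m := (Finsupp.linearCombination ℝ (fun w : Circle => ((w : ℂ), φ w)) l).1 with hm
  by_cases hm0 : m = 0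
  · rw [hm0, norm_zero, mul_zero, neg_zero]
    exact hsum l hl hm0
  · have hn : 0 < ‖m‖ := norm_pos_iff.2 hm0
    obtain ⟨v, hv⟩ : ∃ v : Circle, (v : ℂ) = -((‖m‖ : ℂ)⁻¹ * m) := by
      refine ⟨⟨-((‖m‖ : ℂ)⁻¹ * m), mem_sphere_zero_iff_norm.2 ?_⟩, rfl⟩
      rw [norm_neg, norm_mul, norm_inv, Complex.norm_real, norm_norm, inv_mul_cancel₀ hn.ne']
    have key := hsum (l + Finsupp.single v ‖m‖)
      (add_nonneg hl (Finsupp.single_nonneg.2 hn.le)) (by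
        rw [map_add, Prod.fst_add, ← hm, Finsupp.linearCombination_single, Prod.smul_fst, hv]
        have : (‖m‖ : ℂ) ≠ 0 := by exact_mod_cast hn.ne'
        rw [Complex.real_smul]
        field_simp
        ring)
    rw [map_add, Prod.snd_add, Finsupp.linearCombination_single, Prod.smul_snd, smul_eq_mul] at key
    have := mul_le_mul_of_nonneg_left (hC v) hn.le
    linarith

/-- The moments of the density `u` are an average of points of a convex set, hence lie in its
closure, where the bound by `-C ‖mean‖` persists; here the mean is zero. -/
theorem circleAverage_mul_nonneg_of_two_or_three_points {φ u : ℂ → ℝ}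
    (hφ : ContinuousOn φ (Metric.sphere 0 1)) (hu : ContinuousOn u (Metric.sphere 0 1))
    (hu0 : ∀ w ∈ Metric.sphere (0 : ℂ) 1, 0 ≤ u w)
    (hmean : Real.circleAverage (fun w => (u w : ℂ) * w) 0 1 = 0)
    (h : ∀ (S : Finset Circle) (l : Circle → ℝ), (S.card = 2 ∨ S.card = 3) → (∀ w ∈ S, 0 < l w) →
      ∑ w ∈ S, (l w : ℂ) * w = 0 → 0 ≤ ∑ w ∈ S, l w * φ w) :
    0 ≤ Real.circleAverage (fun w => u w * φ w) 0 1 := by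
  obtain ⟨C, hC⟩ := (isCompact_sphere (0 : ℂ) 1).exists_bound_of_continuousOn hφ
  let G : ℂ → ℂ × ℝ := fun w => ((u w : ℂ) * w, u w * φ w)
  have hG : ContinuousOn G (Metric.sphere 0 1) :=
    ((Complex.continuous_ofReal.comp_continuousOn hu).mul continuousOn_id).prodMk (hu.mul hφ)
  have hGi : CircleIntegrable G 0 1 := hG.circleIntegrable zero_le_one
  have hGm : ∀ w ∈ Metric.sphere (0 : ℂ) 1, G w ∈ atomicMoments φ := by
    intro w hw
    obtain ⟨v, rfl⟩ : ∃ v : Circle, (v : ℂ) = w := ⟨⟨w, hw⟩, rfl⟩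
    refine ⟨Finsupp.single v (u v), Finsupp.single_nonneg.2 (hu0 v hw), ?_⟩
    rw [Finsupp.linearCombination_single]
    simp [G]
  have hmem : Real.circleAverage G 0 1 ∈ closure (atomicMoments φ) := by
    rw [Real.circleAverage_eq_intervalAverage]
    refine (convex_atomicMoments φ).set_average_mem_closure ?_ ?_ ?_ ?_
    · simp [Set.uIoc_of_le Real.two_pi_pos.le, Real.pi_pos]
    · rw [Set.uIoc_of_le Real.two_pi_pos.le]
      exact measure_Ioc_lt_top.ne
    · exact Filter.Eventually.of_forall fun θ => hGm _ (circleMap_mem_sphere 0 zero_le_one θ)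
    · exact (intervalIntegrable_iff.1 hGi)
  have h1 : (Real.circleAverage G 0 1).1 = 0 := by
    refine Eq.trans ?_ hmean
    exact ((ContinuousLinearMap.fst ℝ ℂ ℝ).circleAverage_comp_comm hGi).symm
  have h2 : (Real.circleAverage G 0 1).2 = Real.circleAverage (fun w => u w * φ w) 0 1 :=
    ((ContinuousLinearMap.snd ℝ ℂ ℝ).circleAverage_comp_comm hGi).symm
  have hclosed : IsClosed {p : ℂ × ℝ | -(C * ‖p.1‖) ≤ p.2} :=
    isClosed_le (by fun_prop) (by fun_prop)
  have := closure_minimal (fun p hp => neg_mul_norm_le_of_mem_atomicMoments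
    (fun w => (le_abs_self _).trans (hC w w.2))
    (sum_mul_nonneg_of_two_or_three_points h) hp) hclosed hmem
  change -(C * ‖(Real.circleAverage G 0 1).1‖) ≤ (Real.circleAverage G 0 1).2 at this
  rw [h1, h2] at this
  simpa using this

/-! ### Positivity for functions with positive real part -/

theorem isPositiveKernel_of_re_nonneg {X : Type*} {k : X → X → ℂ}
    (hk : ∀ x y, conj (k y x) = k x y)
    (h : ∀ (s : Finset X) (c : X → ℂ), 0 ≤ (∑ x ∈ s, ∑ y ∈ s, conj (c x) * k x y * c y).re) :
    IsPositiveKernel k := by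
  refine isPositiveKernel_iff.2 ⟨hk, fun s c => ?_⟩
  have hc : conj (∑ x ∈ s, ∑ y ∈ s, conj (c x) * k x y * c y) =
      ∑ x ∈ s, ∑ y ∈ s, conj (c x) * k x y * c y := by
    conv_lhs => rw [Finset.sum_comm]
    simp only [map_sum, map_mul, Complex.conj_conj]
    refine Finset.sum_congr rfl fun x _ => Finset.sum_congr rfl fun y _ => ?_
    rw [hk x y]
    ring
  rw [Complex.nonneg_iff]
  exact ⟨h s c, (Complex.conj_eq_iff_im.1 hc).symm⟩

/-! ### Circle averages and the Herglotz formula. -/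

theorem circleAverage_conj {f : ℂ → ℂ} (hf : CircleIntegrable f 0 1) :
    Real.circleAverage (fun w => conj (f w)) 0 1 = conj (Real.circleAverage f 0 1) :=
  (Complex.conjCLE : ℂ →L[ℝ] ℂ).circleAverage_comp_comm hf

theorem circleAverage_mul_re {f h : ℂ → ℂ} (hf : ContinuousOn f (Metric.sphere 0 1))
    (hh : ContinuousOn h (Metric.sphere 0 1)) :
    Real.circleAverage (fun w => f w * ((h w).re : ℂ)) 0 1 =
      (Real.circleAverage (fun w => f w * h w) 0 1 +
        conj (Real.circleAverage (fun w => conj (f w) * h w) 0 1)) / 2 := by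
  have hf' : ContinuousOn (fun w => conj (f w)) (Metric.sphere 0 1) :=
    Complex.continuous_conj.comp_continuousOn hf
  have hh' : ContinuousOn (fun w => conj (h w)) (Metric.sphere 0 1) :=
    Complex.continuous_conj.comp_continuousOn hh
  have hi : CircleIntegrable (fun w => conj (f w) * h w) 0 1 :=
    (hf'.mul hh).circleIntegrable zero_le_one
  have e : (fun w => f w * ((h w).re : ℂ)) =
      fun w => (2⁻¹ : ℂ) • (f w * h w + f w * conj (h w)) := by
    funext w
    rw [Complex.re_eq_add_conj, smul_eq_mul]
    ring
  rw [e, Real.circleAverage_fun_smul, Real.circleAverage_fun_add (f₁ := fun w => f w * h w)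
    (f₂ := fun w => f w * conj (h w)) ((hf.mul hh).circleIntegrable zero_le_one)
    ((hf.mul hh').circleIntegrable zero_le_one), ← circleAverage_conj hi]
  simp only [map_mul, Complex.conj_conj, smul_eq_mul]
  ring

section Averages

variable {h : ℂ → ℂ} {R : ℝ}

theorem circleAverage_eq_of_differentiableOn (hR : 1 < R)
    (hh : DifferentiableOn ℂ h (Metric.ball 0 R)) : Real.circleAverage h 0 1 = h 0 := by
  refine DiffContOnCl.circleAverage ?_
  rw [abs_one]
  exact hh.diffContOnCl_ball (Metric.closedBall_subset_ball hR)

theorem circleAverage_div_sub_mul (hR : 1 < R) (hh : DifferentiableOn ℂ h (Metric.ball 0 R))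
    {x : ℂ} (hx : ‖x‖ < 1) : Real.circleAverage (fun w => w / (w - x) * h w) 0 1 = h x := by
  have hd : DiffContOnCl ℂ h (Metric.ball 0 |1|) := by
    rw [abs_one]
    exact hh.diffContOnCl_ball (Metric.closedBall_subset_ball hR)
  simpa using hd.circleAverage_smul_div (w := x) (by simpa using hx)

theorem circleAverage_conj_mul (hR : 1 < R) (hh : DifferentiableOn ℂ h (Metric.ball 0 R)) :
    Real.circleAverage (fun w => conj w * h w) 0 1 = deriv h 0 := by
  have h0 : (0 : ℂ) ∈ Metric.ball (0 : ℂ) R := by simp; linarith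
  have hg : DifferentiableOn ℂ (dslope h 0) (Metric.ball 0 R) :=
    (Complex.differentiableOn_dslope (Metric.isOpen_ball.mem_nhds h0)).2 hh
  have hsub : Metric.sphere (0 : ℂ) 1 ⊆ Metric.ball 0 R :=
    Metric.sphere_subset_closedBall.trans (Metric.closedBall_subset_ball hR)
  -- On the circle `conj w = 1/w`, and `h(w)/w = h(0)/w + (h(w) - h(0))/w`; the first term averages
  -- to zero.
  have e : Set.EqOn (fun w => conj w * h w) (fun w => conj (conj (h 0) * w) + dslope h 0 w)
      (Metric.sphere 0 |1|) := by
    intro w hw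
    rw [abs_one, mem_sphere_zero_iff_norm] at hw
    have hw1 : w * conj w = 1 := by
      rw [Complex.mul_conj, Complex.normSq_eq_norm_sq, hw]; simp
    have hs := sub_smul_dslope h 0 w
    simp only [sub_zero, smul_eq_mul] at hs
    simp only [map_mul, Complex.conj_conj]
    linear_combination (-conj w) * hs + dslope h 0 w * hw1
  have hi : CircleIntegrable (fun w => conj (h 0) * w) 0 1 :=
    ContinuousOn.circleIntegrable zero_le_one (by fun_prop)
  rw [Real.circleAverage_congr_sphere e, Real.circleAverage_fun_add
    (ContinuousOn.circleIntegrable zero_le_one (by fun_prop))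
    ((hg.continuousOn.mono hsub).circleIntegrable zero_le_one), circleAverage_conj hi,
    circleAverage_eq_of_differentiableOn hR (h := fun w => conj (h 0) * w) (by fun_prop),
    circleAverage_eq_of_differentiableOn hR hg, dslope_same]
  simp

/-- The kernel `(w + x) / (w - x) + conj ((w + y) / (w - y))`. -/
noncomputable def herglotzPairKernel (x y w : ℂ) : ℂ :=
  (w + x) / (w - x) + conj ((w + y) / (w - y))

theorem conj_herglotzPairKernel (x y w : ℂ) :
    conj (herglotzPairKernel x y w) = herglotzPairKernel y x w := by
  rw [herglotzPairKernel, herglotzPairKernel, map_add, Complex.conj_conj, add_comm]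

theorem continuousOn_herglotzPairKernel {x y : ℂ} (hx : ‖x‖ < 1) (hy : ‖y‖ < 1) :
    ContinuousOn (herglotzPairKernel x y) (Metric.sphere 0 1) := by
  have h : ∀ z : ℂ, ‖z‖ < 1 →
      ContinuousOn (fun w : ℂ => (w + z) / (w - z)) (Metric.sphere 0 1) := by
    intro z hz
    refine ContinuousOn.div (by fun_prop) (by fun_prop) fun w hw => ?_
    exact circle_sub_ne_zero ⟨w, hw⟩ hz
  exact (h x hx).add (Complex.continuous_conj.comp_continuousOn (h y hy))

/-- On the circle the pair kernel equals `w / (w - x)` times `2 (1 - conj(y) x) / (1 - conj(y) w)`,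
so Cauchy's formula applies. The radius `R'` keeps the pole `1 / conj(y)` outside. -/
theorem circleAverage_herglotzPairKernel_mul (hR : 1 < R)
    (hh : DifferentiableOn ℂ h (Metric.ball 0 R)) {x y : ℂ} (hx : ‖x‖ < 1) (hy : ‖y‖ < 1) :
    Real.circleAverage (fun w => herglotzPairKernel x y w * h w) 0 1 = 2 * h x := by
  have hxy : 1 - conj y * x ≠ 0 := one_sub_conj_mul_ne_zero hy.le hx
  obtain ⟨R', hR', hRR', hR'y⟩ : ∃ R' : ℝ, 1 < R' ∧ R' ≤ R ∧ ‖y‖ * R' < 1 := by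
    rcases (norm_nonneg y).eq_or_lt with h0 | h0
    · exact ⟨R, hR, le_rfl, by rw [← h0, zero_mul]; exact one_pos⟩
    · obtain ⟨t, h1t, ht⟩ := exists_between (lt_min hR ((one_lt_div h0).2 hy))
      refine ⟨t, h1t, ht.le.trans (min_le_left _ _), ?_⟩
      have := (lt_div_iff₀ h0).1 (ht.trans_le (min_le_right _ _))
      linarith
  have hG : DifferentiableOn ℂ (fun w => 2 * (1 - conj y * x) / (1 - conj y * w) * h w)
      (Metric.ball 0 R') := by
    refine DifferentiableOn.mul (DifferentiableOn.div (by fun_prop) (by fun_prop) ?_)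
      (hh.mono (Metric.ball_subset_ball hRR'))
    intro w hw e
    rw [mem_ball_zero_iff] at hw
    have : ‖conj y * w‖ = 1 := by rw [← sub_eq_zero.1 e, norm_one]
    rw [norm_mul, Complex.norm_conj] at this
    nlinarith [norm_nonneg y]
  have key := circleAverage_div_sub_mul hR' hG hx
  rw [mul_div_cancel_right₀ _ hxy] at key
  rw [← key]
  refine Real.circleAverage_congr_sphere fun w hw => ?_
  rw [abs_one] at hw
  have hw1 := circle_mul_conj ⟨w, hw⟩
  have d1 : w - x ≠ 0 := circle_sub_ne_zero ⟨w, hw⟩ hx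
  have d2 : w - y ≠ 0 := circle_sub_ne_zero ⟨w, hw⟩ hy
  have d2' : conj w - conj y ≠ 0 := by
    rw [← map_sub]
    exact (map_ne_zero _).2 d2
  rw [mem_sphere_zero_iff_norm] at hw
  have d3 : 1 - conj y * w ≠ 0 := by
    intro e
    have : ‖conj y * w‖ = 1 := by rw [← sub_eq_zero.1 e, norm_one]
    rw [norm_mul, Complex.norm_conj, hw, mul_one] at this
    exact hy.ne this
  change w * conj w = 1 at hw1
  simp only [herglotzPairKernel, map_div₀, map_add, map_sub]
  rw [← mul_assoc]
  congr 1
  rw [div_add_div _ _ d1 d2', div_mul_div_comm, div_eq_div_iff (mul_ne_zero d1 d2')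
    (mul_ne_zero d1 d3)]
  linear_combination (2 * (w - x) * ((1 - conj y * w) - (1 - conj y * x))) * hw1

end Averages

theorem atomicHerglotz_add_conj (S : Finset Circle) (l : Circle → ℝ) (x y : ℂ) :
    atomicHerglotz S l x + conj (atomicHerglotz S l y) =
      ∑ w ∈ S, (l w : ℂ) * herglotzPairKernel x y w := by
  simp only [atomicHerglotz, herglotzPairKernel, map_sum, map_mul, Complex.conj_ofReal, mul_add,
    Finset.sum_add_distrib]

section PositiveRealPart

variable {k : Complex.UnitDisc → Complex.UnitDisc → ℂ}

/-- The Herglotz kernel of two points, summed against a kernel `k` and coefficients `c`. -/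
noncomputable def herglotzForm (k : Complex.UnitDisc → Complex.UnitDisc → ℂ)
    (s : Finset Complex.UnitDisc) (c : Complex.UnitDisc → ℂ) (w : ℂ) : ℂ :=
  ∑ x ∈ s, ∑ y ∈ s, conj (c x) * k x y * c y * herglotzPairKernel x y w

theorem continuousOn_herglotzForm (s : Finset Complex.UnitDisc) (c : Complex.UnitDisc → ℂ) :
    ContinuousOn (herglotzForm k s c) (Metric.sphere 0 1) :=
  continuousOn_finsetSum _ fun x _ => continuousOn_finsetSum _ fun y _ =>
    continuousOn_const.mul (continuousOn_herglotzPairKernel x.norm_lt_one y.norm_lt_one)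

theorem circleAverage_herglotzForm_mul_re (s : Finset Complex.UnitDisc)
    (c : Complex.UnitDisc → ℂ) {h : ℂ → ℂ} {R : ℝ} (hR : 1 < R)
    (hh : DifferentiableOn ℂ h (Metric.ball 0 R)) :
    Real.circleAverage (fun w => herglotzForm k s c w * ((h w).re : ℂ)) 0 1 =
      ∑ x ∈ s, ∑ y ∈ s, conj (c x) * ((h x + conj (h y)) * k x y) * c y := by
  have hc : ContinuousOn h (Metric.sphere 0 1) := hh.continuousOn.mono
    (Metric.sphere_subset_closedBall.trans (Metric.closedBall_subset_ball hR))
  have hp : ∀ x y : Complex.UnitDisc,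
      ContinuousOn (herglotzPairKernel (x : ℂ) y) (Metric.sphere 0 1) := fun x y =>
    continuousOn_herglotzPairKernel x.norm_lt_one y.norm_lt_one
  have hre : ContinuousOn (fun w => ((h w).re : ℂ)) (Metric.sphere 0 1) :=
    Complex.continuous_ofReal.comp_continuousOn (Complex.continuous_re.comp_continuousOn hc)
  have hpair : ∀ x y : Complex.UnitDisc,
      Real.circleAverage (fun w => herglotzPairKernel x y w * ((h w).re : ℂ)) 0 1 =
        h x + conj (h y) := by
    intro x y
    rw [circleAverage_mul_re (hp x y) hc]
    simp only [conj_herglotzPairKernel]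
    rw [circleAverage_herglotzPairKernel_mul hR hh x.norm_lt_one y.norm_lt_one,
      circleAverage_herglotzPairKernel_mul hR hh y.norm_lt_one x.norm_lt_one]
    simp only [map_mul, map_ofNat]
    ring
  have e : (fun w => herglotzForm k s c w * ((h w).re : ℂ)) = fun w => ∑ x ∈ s, ∑ y ∈ s,
      (conj (c x) * k x y * c y) • (herglotzPairKernel x y w * ((h w).re : ℂ)) := by
    funext w
    simp only [herglotzForm, Finset.sum_mul, smul_eq_mul, mul_assoc]
  have hq : ∀ x y : Complex.UnitDisc, ContinuousOn (fun w => (conj (c x) * k x y * c y) •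
      (herglotzPairKernel x y w * ((h w).re : ℂ))) (Metric.sphere 0 1) := fun x y => by
    have := (hp x y).mul hre
    exact this.const_smul (conj (c x) * k x y * c y)
  have hi : ∀ x y : Complex.UnitDisc, CircleIntegrable (fun w => (conj (c x) * k x y * c y) •
      (herglotzPairKernel x y w * ((h w).re : ℂ))) 0 1 := fun x y =>
    (hq x y).circleIntegrable zero_le_one
  rw [e, Real.circleAverage_fun_sum
    (f := fun x w => ∑ y ∈ s, (conj (c x) * k x y * c y) •
      (herglotzPairKernel (x : ℂ) (y : ℂ) w * ((h w).re : ℂ)))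
    fun x _ => ContinuousOn.circleIntegrable zero_le_one
      (continuousOn_finsetSum _ fun y _ => hq x y)]
  refine Finset.sum_congr rfl fun x _ => ?_
  rw [Real.circleAverage_fun_sum (f := fun (y : Complex.UnitDisc) w =>
    (conj (c x) * k x y * c y) • (herglotzPairKernel (x : ℂ) (y : ℂ) w * ((h w).re : ℂ)))
    fun y _ => hi x y]
  refine Finset.sum_congr rfl fun y _ => ?_
  rw [Real.circleAverage_fun_smul, hpair, smul_eq_mul]
  ring

/-- After normalising the total mass, this is admissibility of `k` read as an integral of
`herglotzForm` against an atomic measure. -/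
theorem sum_mul_re_herglotzForm_nonneg (hk : k ∈ kernels testFamily)
    (s : Finset Complex.UnitDisc) (c : Complex.UnitDisc → ℂ) {S : Finset Circle}
    {l : Circle → ℝ} (hc : S.card = 2 ∨ S.card = 3) (hl : ∀ w ∈ S, 0 < l w)
    (h0 : ∑ w ∈ S, (l w : ℂ) * w = 0) : 0 ≤ ∑ w ∈ S, l w * (herglotzForm k s c w).re := by
  have hne : S.Nonempty := Finset.card_pos.1 (by omega)
  set T := ∑ w ∈ S, l w with hTdef
  have hT : 0 < T := Finset.sum_pos hl hne
  have hpos := isPositiveKernel_re_atomicHerglotz hk hc (l := fun w => l w / T)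
    (fun w hw => div_pos (hl w hw) hT)
    (by rw [← Finset.sum_div, ← hTdef, div_self hT.ne'])
    (by
      have : ∑ w ∈ S, ((l w / T : ℝ) : ℂ) * w = (∑ w ∈ S, (l w : ℂ) * w) / T := by
        rw [Finset.sum_div]
        exact Finset.sum_congr rfl fun w _ => by push_cast; ring
      rw [this, h0, zero_div])
  have h := (Complex.nonneg_iff.1 ((isPositiveKernel_iff.1 hpos).2 s c)).1
  have e : ∑ x ∈ s, ∑ y ∈ s, conj (c x) * ((atomicHerglotz S (fun w => l w / T) x +
      conj (atomicHerglotz S (fun w => l w / T) y)) * k x y) * c y =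
      ∑ w ∈ S, ((l w / T : ℝ) : ℂ) * herglotzForm k s c w := by
    simp only [herglotzForm, Finset.mul_sum]
    conv_rhs => rw [Finset.sum_comm]
    refine Finset.sum_congr rfl fun x _ => ?_
    rw [Finset.sum_comm]
    refine Finset.sum_congr rfl fun y _ => ?_
    rw [atomicHerglotz_add_conj, Finset.sum_mul, Finset.mul_sum, Finset.sum_mul]
    refine Finset.sum_congr rfl fun w _ => ?_
    ring
  rw [e, Complex.re_sum] at h
  simp only [Complex.re_ofReal_mul, div_mul_eq_mul_div] at h
  rw [← Finset.sum_div] at h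
  have := mul_nonneg h hT.le
  rwa [div_mul_cancel₀ _ hT.ne'] at this

/-- A kernel that is admissible for the test functions stays positive after multiplication by
`h(x) + conj(h(y))`, for `h` with nonnegative real part and vanishing derivative at `0`. -/
theorem isPositiveKernel_add_conj_mul (hk : k ∈ kernels testFamily) {h : ℂ → ℂ} {R : ℝ}
    (hR : 1 < R) (hh : DifferentiableOn ℂ h (Metric.ball 0 R))
    (hre : ∀ w ∈ Metric.sphere (0 : ℂ) 1, 0 ≤ (h w).re) (hd : deriv h 0 = 0) :
    IsPositiveKernel (fun x y : Complex.UnitDisc => (h x + conj (h y)) * k x y) := by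
  refine isPositiveKernel_of_re_nonneg (fun x y => ?_) fun s c => ?_
  · rw [← (isPositiveKernel_iff.1 hk.1).1 x y]
    simp [add_comm]
  have hc : ContinuousOn h (Metric.sphere 0 1) := hh.continuousOn.mono
    (Metric.sphere_subset_closedBall.trans (Metric.closedBall_subset_ball hR))
  have hcre : ContinuousOn (fun w => (h w).re) (Metric.sphere 0 1) :=
    Complex.continuous_re.comp_continuousOn hc
  -- The first moment of `Re h` is `conj(h'(0)) / 2`; this is where the constraint on the derivative
  -- enters.
  have hmean : Real.circleAverage (fun w => ((h w).re : ℂ) * w) 0 1 = 0 := by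
    simp_rw [mul_comm _ (_ : ℂ)]
    rw [circleAverage_mul_re (f := fun w => w) continuousOn_id hc]
    have h1 := circleAverage_eq_of_differentiableOn hR (h := fun w => w * h w)
      (differentiableOn_id.mul hh)
    have h2 := circleAverage_conj_mul hR hh
    rw [h1, h2, hd]
    simp
  have key := circleAverage_mul_nonneg_of_two_or_three_points
    (Complex.continuous_re.comp_continuousOn (continuousOn_herglotzForm (k := k) s c)) hcre hre
    hmean fun S l hc hl h0 => sum_mul_re_herglotzForm_nonneg hk s c hc hl h0
  have hi : CircleIntegrable (fun w => herglotzForm k s c w * ((h w).re : ℂ)) 0 1 :=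
    ContinuousOn.circleIntegrable zero_le_one ((continuousOn_herglotzForm s c).mul
      (Complex.continuous_ofReal.comp_continuousOn hcre))
  rw [← circleAverage_herglotzForm_mul_re s c hR hh]
  refine key.trans_eq ?_
  refine Eq.trans ?_ (Complex.reCLM.circleAverage_comp_comm hi)
  congr 1
  funext w
  simp [mul_comm]

/-- The strict bound keeps `1 - F` away from zero, so the Cayley transform `h` exists; the dilates
`h(ρ z)` are holomorphic on a disc of radius `ρ⁻¹ > 1`, and `ρ` then tends to 1. -/
theorem isPositiveKernel_pickKernel_of_norm_le (hk : k ∈ kernels testFamily) {F : ℂ → ℂ}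
    (hF : DifferentiableOn ℂ F (Metric.ball 0 1)) (hd : deriv F 0 = 0) {r : ℝ} (hr : r < 1)
    (hb : ∀ z ∈ Metric.ball (0 : ℂ) 1, ‖F z‖ ≤ r) :
    IsPositiveKernel (pickKernel (fun z : Complex.UnitDisc => F z) k) := by
  have hne : ∀ z ∈ Metric.ball (0 : ℂ) 1, 1 - F z ≠ 0 := fun z hz => by
    simpa using circle_sub_ne_zero 1 ((hb z hz).trans_lt hr)
  have hne' : ∀ z : Complex.UnitDisc, 1 - F z ≠ 0 := fun z =>
    hne z (mem_ball_zero_iff.2 z.norm_lt_one)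
  have h0 : (0 : ℂ) ∈ Metric.ball (0 : ℂ) 1 := by simp
  set h : ℂ → ℂ := fun z => (1 + F z) / (1 - F z) with hh
  have hdiff : DifferentiableOn ℂ h (Metric.ball 0 1) :=
    ((differentiableOn_const _).add hF).div ((differentiableOn_const _).sub hF) hne
  have hderiv : HasDerivAt h 0 0 := by
    have hF0 : HasDerivAt F 0 0 := by
      have := (hF.differentiableAt (Metric.isOpen_ball.mem_nhds h0)).hasDerivAt
      rwa [hd] at this
    simpa using (hF0.const_add 1).fun_div (hF0.const_sub 1) (hne 0 h0)
  have hre : ∀ z ∈ Metric.ball (0 : ℂ) 1, 0 ≤ (h z).re := fun z hz => by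
    simpa using (re_herglotz_kernel_pos 1 ((hb z hz).trans_lt hr)).le
  have hplus : ∀ z : Complex.UnitDisc, h z + 1 = 2 / (1 - F z) := fun z => by
    have := hne' z
    simp only [hh]
    field_simp
    ring
  have hminus : ∀ z : Complex.UnitDisc, h z - 1 = 2 * F z / (1 - F z) := fun z => by
    have := hne' z
    simp only [hh]
    field_simp
    ring
  have e : (fun z : Complex.UnitDisc => F z) =
      fun z : Complex.UnitDisc => (h z - 1) / (h z + 1) := by
    funext z
    have := hne' z
    rw [hplus, hminus]
    field_simp
  rw [e, isPositiveKernel_pickKernel_cayley (h := fun z : Complex.UnitDisc => h z)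
    fun z => by rw [hplus]; exact div_ne_zero two_ne_zero (hne' z)]
  have hlim : ∀ z : Complex.UnitDisc, Filter.Tendsto (fun ρ : ℝ => h (ρ * z))
      (nhdsWithin 1 (Set.Iio 1)) (nhds (h z)) := by
    intro z
    have hcz : ContinuousAt h z := (hdiff.differentiableAt (Metric.isOpen_ball.mem_nhds
      (mem_ball_zero_iff.2 z.norm_lt_one))).continuousAt
    have ht : Filter.Tendsto (fun ρ : ℝ => (ρ : ℂ) * z) (nhdsWithin 1 (Set.Iio 1))
        (nhds (z : ℂ)) := by
      have : Continuous fun ρ : ℝ => (ρ : ℂ) * z := by fun_prop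
      simpa using (this.tendsto 1).mono_left nhdsWithin_le_nhds
    exact hcz.tendsto.comp ht
  refine isPositiveKernel_of_tendsto (u := nhdsWithin (1 : ℝ) (Set.Iio 1))
    (k := fun ρ (x y : Complex.UnitDisc) => (h (ρ * x) + conj (h (ρ * y))) * k x y) ?_ fun x y =>
      ((hlim x).add ((Complex.continuous_conj.tendsto _).comp (hlim y))).mul_const _
  filter_upwards [Ioo_mem_nhdsLT (zero_lt_one' ℝ)] with ρ hρ
  refine isPositiveKernel_add_conj_mul hk (h := fun z => h (ρ * z)) (R := ρ⁻¹)
    ((one_lt_inv₀ hρ.1).2 hρ.2) ?_ ?_ ?_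
  · refine hdiff.comp (by fun_prop) fun z hz => ?_
    rw [mem_ball_zero_iff] at hz ⊢
    rw [norm_mul, Complex.norm_real, Real.norm_of_nonneg hρ.1.le]
    calc ρ * ‖z‖ < ρ * ρ⁻¹ := mul_lt_mul_of_pos_left hz hρ.1
      _ = 1 := mul_inv_cancel₀ hρ.1.ne'
  · intro w hw
    refine hre _ ?_
    rw [mem_sphere_zero_iff_norm] at hw
    rw [mem_ball_zero_iff, norm_mul, Complex.norm_real, Real.norm_of_nonneg hρ.1.le, hw, mul_one]
    exact hρ.2
  · rw [deriv_comp_mul_left, mul_zero, hderiv.deriv, smul_zero]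

end PositiveRealPart

/-! ### The unit ball of the kernel space -/

theorem smul_mem_hInftyOne {f : Complex.UnitDisc → ℂ} (hf : f ∈ hInftyOne) (r : ℝ) :
    r • f ∈ hInftyOne := by
  obtain ⟨⟨F, hF, hd, h0⟩, M, hM⟩ := hf
  refine ⟨⟨fun z => (r : ℂ) * F z, fun z => by simp [hF], hd.const_mul _, ?_⟩, |r| * M, fun z => ?_⟩
  · rw [deriv_const_mul_field, h0, mul_zero]
  · rw [Pi.smul_apply, norm_smul, Real.norm_eq_abs]
    exact mul_le_mul_of_nonneg_left (hM z) (abs_nonneg r)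

theorem mem_kernelUnitBall_of_mem_hInftyOne {f : Complex.UnitDisc → ℂ} (hf : f ∈ hInftyOne)
    (hb : ∀ z, ‖f z‖ ≤ 1) : f ∈ kernelUnitBall (kernels testFamily) := by
  intro k hk
  obtain ⟨⟨F, hF, hd, h0⟩, -⟩ := hf
  obtain rfl : (fun z : Complex.UnitDisc => F z) = f := funext hF
  have hlim : ∀ z : ℂ, Filter.Tendsto (fun r : ℝ => (r : ℂ) * z)
      (nhdsWithin 1 (Set.Iio 1)) (nhds z) := by
    intro z
    have : Continuous fun r : ℝ => (r : ℂ) * z := by fun_prop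
    simpa using (this.tendsto 1).mono_left nhdsWithin_le_nhds
  refine isPositiveKernel_of_tendsto (u := nhdsWithin (1 : ℝ) (Set.Iio 1))
    (k := fun r => pickKernel (fun z : Complex.UnitDisc => (r : ℂ) * F z) k) ?_ fun x y =>
      (((hlim (F x)).mul ((Complex.continuous_conj.tendsto _).comp
        (hlim (F y)))).const_sub 1).mul_const _
  filter_upwards [Ioo_mem_nhdsLT (zero_lt_one' ℝ)] with r hr
  refine isPositiveKernel_pickKernel_of_norm_le hk (F := fun z => (r : ℂ) * F z)
    (hd.const_mul _) ?_ hr.2 fun z hz => ?_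
  · rw [deriv_const_mul_field, h0, mul_zero]
  · rw [norm_mul, Complex.norm_real, Real.norm_of_nonneg hr.1.le]
    exact mul_le_of_le_one_right hr.1.le (hb (Complex.UnitDisc.mk z (mem_ball_zero_iff.1 hz)))

theorem mem_kernelUnitBall_iff {f : Complex.UnitDisc → ℂ} :
    f ∈ kernelUnitBall (kernels testFamily) ↔ f ∈ hInftyOne ∧ ∀ z, ‖f z‖ ≤ 1 :=
  ⟨fun hf => ⟨mem_hInftyOne_of_isPositiveKernel_pickKernel (hf _ gapKernel_mem_kernels),
    norm_le_one_of_isPositiveKernel_pickKernel (hf _ gapKernel_mem_kernels)⟩,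
    fun hf => mem_kernelUnitBall_of_mem_hInftyOne hf.1 hf.2⟩

theorem inv_smul_mem_kernelUnitBall_iff {f : Complex.UnitDisc → ℂ} (hf : f ∈ hInftyOne) {r : ℝ}
    (hr : 0 < r) : r⁻¹ • f ∈ kernelUnitBall (kernels testFamily) ↔ ∀ z, ‖f z‖ ≤ r := by
  rw [mem_kernelUnitBall_iff, and_iff_right (smul_mem_hInftyOne hf _)]
  refine forall_congr' fun z => ?_
  rw [Pi.smul_apply, norm_smul, Real.norm_of_nonneg (inv_nonneg.2 hr.le), inv_mul_le_iff₀ hr,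
    mul_one]

theorem kernelSpace_testFamily : kernelSpace (kernels testFamily) = hInftyOne := by
  ext f
  constructor
  · rintro ⟨r, hr, hf⟩
    have := smul_mem_hInftyOne (mem_kernelUnitBall_iff.1 hf).1 r
    rwa [smul_inv_smul₀ hr.ne'] at this
  · intro hf
    obtain ⟨M, hM⟩ := hf.2
    refine ⟨max M 1, by positivity, ?_⟩
    rw [inv_smul_mem_kernelUnitBall_iff hf (by positivity)]
    exact fun z => (hM z).trans (le_max_left _ _)

theorem kernelNorm_testFamily {f : Complex.UnitDisc → ℂ} (hf : f ∈ hInftyOne) :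
    kernelNorm (kernels testFamily) f = supNorm f := by
  obtain ⟨M, hM⟩ := hf.2
  have hbdd : BddAbove (Set.range fun z => ‖f z‖) := ⟨M, Set.forall_mem_range.2 hM⟩
  have hle : ∀ z, ‖f z‖ ≤ supNorm f := le_ciSup hbdd
  have h0 : 0 ≤ supNorm f := (norm_nonneg _).trans (hle 0)
  have hset : {r : ℝ | 0 < r ∧ r⁻¹ • f ∈ kernelUnitBall (kernels testFamily)} =
      {r : ℝ | 0 < r ∧ supNorm f ≤ r} := by
    ext r
    refine and_congr_right fun hr => ?_
    rw [inv_smul_mem_kernelUnitBall_iff hf hr]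
    exact ⟨fun h => ciSup_le h, fun h z => (hle z).trans h⟩
  rw [kernelNorm, hset]
  refine IsGLB.csInf_eq ⟨fun r hr => hr.2, fun b hb => ?_⟩ ⟨supNorm f + 1, by positivity, by simp⟩
  -- For `f = 0` the infimum is not attained, since `r` must be positive; hence the `ε`.
  refine le_of_forall_pos_le_add fun ε hε => hb ⟨by positivity, by linarith⟩

/-! ### The test functions separate points -/

/-- Lagrange interpolation: the indicator of a point is a product of functions separating it from
each of the others. -/
theorem subalgebra_eq_top_of_separates {X : Type*} [Fintype X] (A : Subalgebra ℂ (X → ℂ))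
    (h : ∀ x y, x ≠ y → ∃ g ∈ A, g x ≠ g y) : A = ⊤ := by
  classical
  have hsep : ∀ x y, ∃ g ∈ A, g x = 1 ∧ (x ≠ y → g y = 0) := by
    intro x y
    by_cases hxy : x = y
    · exact ⟨1, A.one_mem, rfl, fun h => absurd hxy h⟩
    · obtain ⟨g, hg, hne⟩ := h x y hxy
      refine ⟨(g x - g y)⁻¹ • (g - algebraMap ℂ (X → ℂ) (g y)),
        A.smul_mem (A.sub_mem hg (A.algebraMap_mem _)) _, ?_, fun _ => ?_⟩
      · simp [sub_ne_zero.2 hne]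
      · simp
  choose g hgA hg1 hg0 using hsep
  have hsingle : ∀ x, Pi.single x (1 : ℂ) ∈ A := by
    intro x
    have e : Pi.single x (1 : ℂ) = ∏ y, g x y := by
      funext z
      rw [Finset.prod_apply]
      by_cases hz : x = z
      · subst hz
        simp [hg1]
      · rw [Pi.single_eq_of_ne (Ne.symm hz),
          Finset.prod_eq_zero (f := fun y => g x y z) (Finset.mem_univ z) (hg0 x z hz)]
    rw [e]
    exact A.prod_mem fun y _ => hgA x y
  rw [eq_top_iff]
  intro f _
  have e : f = ∑ x, f x • Pi.single x (1 : ℂ) := by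
    funext z
    simp [Finset.sum_apply, Pi.single_apply]
  rw [e]
  exact A.sum_mem fun x _ => A.smul_mem (hsingle x) _

theorem norm_cubicBlaschke_le {a z : ℂ} (ha : ‖a‖ < 1) (hz : ‖z‖ < 1) :
    ‖cubicBlaschke a z‖ ≤ ‖z‖ ^ 2 := by
  have h0 : 0 < ‖1 - conj a * z‖ := norm_pos_iff.2 (one_sub_conj_mul_ne_zero ha.le hz)
  have e : ‖1 - conj a * z‖ ^ 2 - ‖z - a‖ ^ 2 = (1 - ‖a‖ ^ 2) * (1 - ‖z‖ ^ 2) := by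
    -- Expanding in real coordinates proves the identity showing that the Möbius factor has modulus
    -- at most one.
    simp only [← Complex.normSq_eq_norm_sq, Complex.normSq_apply, Complex.sub_re, Complex.sub_im,
      Complex.mul_re, Complex.mul_im, Complex.conj_re, Complex.conj_im, Complex.one_re,
      Complex.one_im]
    ring
  have hle : ‖z - a‖ ≤ ‖1 - conj a * z‖ := by
    rw [← sq_le_sq₀ (norm_nonneg _) (norm_nonneg _), ← sub_nonneg, e]
    have h1 : ‖a‖ ^ 2 ≤ 1 := pow_le_one₀ (norm_nonneg _) ha.le
    have h2 : ‖z‖ ^ 2 ≤ 1 := pow_le_one₀ (norm_nonneg _) hz.le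
    exact mul_nonneg (sub_nonneg.2 h1) (sub_nonneg.2 h2)
  rw [cubicBlaschke, norm_div, norm_mul, norm_pow, div_le_iff₀ h0]
  exact mul_le_mul_of_nonneg_left hle (by positivity)

theorem isTestFunctionSet_testFamily : IsTestFunctionSet testFamily := by
  refine ⟨fun x => ⟨‖(x : ℂ)‖ ^ 2, x.sq_norm_lt_one, fun ψ hψ => ?_⟩, fun F => ?_⟩
  · obtain ⟨u, hu, rfl | ⟨a, ha, rfl⟩⟩ := eq_sq_or_eq_cubicBlaschke_of_mem_testFamily hψ
    · simp [hu]
    · simpa [hu] using norm_cubicBlaschke_le ha x.norm_lt_one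
  · obtain ⟨u, hu, h2⟩ := exists_sq_mem_testFamily
    -- For `a = 0` this is `z³`, and `z²` and `z³` together separate points.
    obtain ⟨v, hv, h3⟩ := exists_cubicBlaschke_mem_testFamily (a := 0) (by simp)
    have hu0 : u ≠ 0 := by
      rintro rfl
      simp at hu
    have hv0 : v ≠ 0 := by
      rintro rfl
      simp at hv
    have htop : Algebra.adjoin ℂ
        ((fun (ψ : Complex.UnitDisc → ℂ) (x : F) => ψ x) '' testFamily) = ⊤ := by
      refine subalgebra_eq_top_of_separates _ fun x y hxy => ?_
      by_contra! hall
      have e2 := hall _ (Algebra.subset_adjoin ⟨_, h2, rfl⟩)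
      have e3 := hall _ (Algebra.subset_adjoin ⟨_, h3, rfl⟩)
      simp only [cubicBlaschke, map_zero, zero_mul, sub_zero, div_one] at e2 e3
      have e2' := mul_left_cancel₀ hu0 e2
      have e3' := mul_left_cancel₀ hv0 e3
      apply hxy
      apply Subtype.ext
      apply Complex.UnitDisc.coe_injective
      by_cases hx : ((x : Complex.UnitDisc) : ℂ) ^ 2 = 0
      · rw [hx] at e2'
        rw [pow_eq_zero_iff two_ne_zero |>.1 hx, pow_eq_zero_iff two_ne_zero |>.1 e2'.symm]
      · rw [← e2'] at e3'
        exact mul_left_cancel₀ hx e3'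
    rw [htop, ← Subalgebra.finrank_toSubmodule, Algebra.top_toSubmodule, finrank_top]
    simp

end ConstrainedInterpolation

theorem mainTheorem1 :
    ConstrainedInterpolation.IsTestFunctionSet ConstrainedInterpolation.testFamily ∧
    ConstrainedInterpolation.kernelSpace
        (ConstrainedInterpolation.kernels ConstrainedInterpolation.testFamily) =
      ConstrainedInterpolation.hInftyOne ∧
    ∀ f ∈ ConstrainedInterpolation.hInftyOne,
      ConstrainedInterpolation.kernelNorm
          (ConstrainedInterpolation.kernels ConstrainedInterpolation.testFamily) f =
        ConstrainedInterpolation.supNorm f :=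
  ⟨ConstrainedInterpolation.isTestFunctionSet_testFamily,
    ConstrainedInterpolation.kernelSpace_testFamily,
    fun _ hf => ConstrainedInterpolation.kernelNorm_testFamily hf⟩
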